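/- **Setting (scalar online LASSO with noisy predictions).** Fix integers $T\ge 1$ (horizon), $w\ge 0$ and reals $\beta>0$, $\sigma>0$. Let $f:\mathbb Z\to\mathbb R$ satisfy $f(0)=1$ and $f(t)=0$ for $t<0$. Let $\hat y_1,\dots,\hat y_T\in\mathbb R$ be arbitrary initial predictions, and let $e(1),\dots,e(T)$ be i.i.d. real random variables with mean $0$, variance $\sigma^2$ and $|e(s)|\le\varepsilon$ almost surely. The targets and their predictions made at time $\tau$ are $$y_t=\hat y_t+\sum_{s=1}^t f(t-s)e(s),\qquad y_{t|\tau}=\hat y_t+\sum_{s=1}^{\tau} f(t-s)e(s)\quad(\tau<t),$$ with $y_{t|\tau}=\hat y_t$ for $\tau\le 0$. With $x_t=0$ for $t\le 0$, the cost of actions $x_1,\dots,x_T\in\mathbb R$ is $\mathrm{cost}(x)=\sum_{t=1}^T\tfrac12(y_t-x_t)^2+\beta|x_t-x_{t-1}|$; $x^*$ denotes its minimiser and $\mathrm{cost}(OPT)$ its minimum. For $k=0,\dots,w$ let $\Omega_k=\{\tau\in\mathbb Z: -w\le\tau\le T,\ \tau\equiv k \bmod (w+1)\}$. The $k$-th fixed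 horizon control algorithm chooses, at each $\tau\in\Omega_k$, actions $x^{(k)}_t$ for the slots $t\in\{\tau,\dots,\tau+w\}\cap\{1,\dots,T\}$ minimising $\sum_t \tfrac12(y_{t|\tau-1}-x_t)^2+\beta|x_t-x_{t-1}|$ over these slots, given the preceding action $x^{(k)}$ (which is $0$ at times $\le 0$). AFHC plays $x_t=\frac1{w+1}\sum_{k=0}^w x^{(k)}_t$. Put $$g_1=\frac1{w+1}\sum_{k=0}^w\sum_{\tau\in\Omega_k}\beta\,|x^*_{\tau-1}-x^{(k)}_{\tau-1}|,\qquad g_2=\frac1{w+1}\sum_{k=0}^w\sum_{\tau\in\Omega_k}\ \sum_{\substack{\tau\le t\le\tau+w\\ 1\le t\le T}}\tfrac12\,(y_t-y_{t|\tau-1})^2,$$ $$\|f_w\|^2=\sigma^2\sum_{s=0}^w f(s)^2,\quad F(w)=\sigma^2\sum_{s=0}^w(w-s+1)f(s)^2,\quad V_1=\frac{3\beta^2T+\beta T\|f_w\|}{w+1},\quad V_2=\frac{T\,F(w)}{2(w+1)},\quad V_T=V_1+V_2 .$$ Let $A_k$ be the $T\times T$ matrix whose $(t,s)$ entry is $f(t-s)$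 if $\tau\le s\le t\le\tau+w$ for some $\tau\in\Omega_k$ and $0$ otherwise, let $A$ be the matrix obtained by stacking $A_0,\dots,A_w$ and dividing by $\sqrt{w+1}$, so that $A^TA=\frac1{w+1}\sum_{k=0}^wA_k^TA_k$, and let $\lambda$ be the largest eigenvalue of $AA^T$. **Theorem.** For every realisation of $e$, $$\mathrm{cost}(AFHC)-\mathrm{cost}(OPT)\le g_1+g_2,\qquad g_2=\tfrac12\|Ae\|^2,$$ and $\lambda\le F(w)/\sigma^2$. The random variables $g_1$, $g_2$ and $\mathrm{cost}(AFHC)-\mathrm{cost}(OPT)$ are integrable, with means at most $V_1$, $V_2$ and $V_T$ respectively. For every $u>0$, $$\mathbb P(g_1>V_1+u)\le\exp\left(\frac{-u^2}{2\varepsilon^2\frac{\beta^2T}{(w+1)\sigma^2}\|f_w\|^2}\right),\qquad \mathbb P(g_2>V_2+u)\le\exp\left(\frac{-u^2}{8\varepsilon^2\lambda\left(\frac{T}{w+1}F(w)+u\right)}\right),$$ $$\mathbb P\big(\mathrm{cost}(AFHC)-\mathrm{cost}(OPT)>V_T+u\big)\le\exp\left(\frac{-u^2}{8\varepsilon^2\frac{\beta^2T}{(w+1)\sigma^2}\|f_w\|^2}\right)+\exp\left(\frac{-u^2}{16\varepsilon^2\lambda\left(\frac{2T}{w+1}F(w)+u\right)}\right)\le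 2\exp\left(\frac{-u^2}{a+bu}\right),$$ where $a=\frac{8\varepsilon^2T}{w+1}\max\left(\frac{\beta^2\|f_w\|^2}{\sigma^2},\,4\lambda F(w)\right)$ and $b=16\varepsilon^2\lambda$. -/

import Mathlib

open MeasureTheory ProbabilityTheory

namespace OnlineLasso

/-! Time slots are integers. The cost-bearing slots are `1, …, T`. A noise path is `e : ℤ → ℝ`, of
which only `e 1, …, e T` are used, and an action sequence is `x : ℤ → ℝ` with `x t = 0` for
`t ≤ 0`. -/

/-- `y_{t|τ} = ŷ_t + ∑_{s=1}^{τ} f(t-s) e(s)`, the prediction of `y_t` made at time `τ`.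
For `τ ≤ 0` the sum is empty and this is the initial prediction `ŷ_t`. -/
noncomputable def prediction (f yhat e : ℤ → ℝ) (τ t : ℤ) : ℝ :=
  yhat t + ∑ s ∈ Finset.Icc 1 τ, f (t - s) * e s

/-- `y_t = ŷ_t + ∑_{s=1}^{t} f(t-s) e(s)`, the realised target. -/
noncomputable def target (f yhat e : ℤ → ℝ) (t : ℤ) : ℝ :=
  yhat t + ∑ s ∈ Finset.Icc 1 t, f (t - s) * e s

/-- `∑_{t=a}^{b} ½ (z_t - x_t)² + β |x_t - x_{t-1}|`. -/
noncomputable def windowCost (β : ℝ) (z : ℤ → ℝ) (a b : ℤ) (x : ℤ → ℝ) : ℝ :=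
  ∑ t ∈ Finset.Icc a b, ((1 / 2) * (z t - x t) ^ 2 + β * |x t - x (t - 1)|)

/-- The total cost over the horizon `1, …, T`. -/
noncomputable def cost (β : ℝ) (T : ℕ) (y x : ℤ → ℝ) : ℝ := windowCost β y 1 T x

/-- `x_a, …, x_b` minimise the cost of the window `[a, b]` with targets `z`, given `x_{a-1}`. -/
def SolvesWindow (β : ℝ) (z : ℤ → ℝ) (a b : ℤ) (x : ℤ → ℝ) : Prop :=
  ∀ v : ℤ → ℝ, v (a - 1) = x (a - 1) → windowCost β z a b x ≤ windowCost β z a b v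

/-- `x` is an optimal dynamic offline solution. -/
def IsOpt (β : ℝ) (T : ℕ) (y x : ℤ → ℝ) : Prop :=
  (∀ t ≤ 0, x t = 0) ∧ SolvesWindow β y 1 T x

/-- `Ω_k = {τ : τ ≡ k mod (w+1)} ∩ [-w, T]`. -/
noncomputable def startTimes (w T k : ℕ) : Finset ℤ :=
  (Finset.Icc (-(w : ℤ)) (T : ℤ)).filter (fun τ => τ ≡ (k : ℤ) [ZMOD ((w : ℤ) + 1)])

/-- The slots of `{1, …, T}` covered by the window `τ, …, τ + w`. -/
noncomputable def windowSlots (w T : ℕ) (τ : ℤ) : Finset ℤ := Finset.Icc (max τ 1) (min (τ + w) T)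

/-- `x` is an action sequence of the `k`-th fixed horizon control algorithm: at every `τ ∈ Ω_k` it
solves the window `τ, …, τ + w` with the predictions made at time `τ - 1`, starting from
`x_{τ-1}`. Actions at times `t ≤ 0` are `0`, and slots after `T` carry no cost. -/
def IsFHC (β : ℝ) (w T k : ℕ) (f yhat e x : ℤ → ℝ) : Prop :=
  (∀ t ≤ 0, x t = 0) ∧
    ∀ τ ∈ startTimes w T k,
      SolvesWindow β (prediction f yhat e (τ - 1)) (max τ 1) (min (τ + w) T) x

theorem windowCost_congr (β : ℝ) (z : ℤ → ℝ) (a b : ℤ) (x v : ℤ → ℝ)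
    (h : ∀ t, a - 1 ≤ t → t ≤ b → x t = v t) :
    windowCost β z a b x = windowCost β z a b v := by
  unfold windowCost
  refine Finset.sum_congr rfl fun t ht => ?_
  rw [Finset.mem_Icc] at ht
  rw [h t (by omega) ht.2, h (t - 1) (by omega) (by omega)]

theorem exists_window_min (β : ℝ) (hβ : 0 ≤ β) (z : ℤ → ℝ) (a b : ℤ) (x : ℤ → ℝ) :
    ∃ v : ℤ → ℝ, (∀ t, t ∉ Finset.Icc a b → v t = x t) ∧ SolvesWindow β z a b v := by
  classical
  let ext : (Finset.Icc a b → ℝ) → ℤ → ℝ :=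
    fun u t => if h : t ∈ Finset.Icc a b then u ⟨t, h⟩ else x t
  have hext : ∀ t, Continuous fun u => ext u t := by
    intro t
    by_cases h : t ∈ Finset.Icc a b
    · simp only [ext, dif_pos h]
      exact continuous_apply _
    · simp only [ext, dif_neg h]
      exact continuous_const
  have hc : Continuous fun u => windowCost β z a b (ext u) := by
    unfold windowCost
    refine continuous_finsetSum _ fun t _ => ?_
    have h1 := hext t
    have h2 := hext (t - 1)
    fun_prop
  let u0 : Finset.Icc a b → ℝ := fun t => z t
  have hterm : ∀ (v : ℤ → ℝ) (t : ℤ),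
      0 ≤ (1 / 2) * (z t - v t) ^ 2 + β * |v t - v (t - 1)| := by
    intro v t
    have := mul_nonneg hβ (abs_nonneg (v t - v (t - 1)))
    have := sq_nonneg (z t - v t)
    linarith
  have hlow : ∀ (v : ℤ → ℝ), ∀ t ∈ Finset.Icc a b,
      (1 / 2) * (z t - v t) ^ 2 ≤ windowCost β z a b v := by
    intro v t ht
    have h1 := Finset.single_le_sum (f := fun t => (1 / 2) * (z t - v t) ^ 2
      + β * |v t - v (t - 1)|) (fun i _ => hterm v i) ht
    have h2 := mul_nonneg hβ (abs_nonneg (v t - v (t - 1)))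
    unfold windowCost
    linarith
  let C := windowCost β z a b (ext u0)
  have hC : 0 ≤ C := Finset.sum_nonneg fun i _ => hterm _ i
  let B : Set (Finset.Icc a b → ℝ) :=
    Set.pi Set.univ fun t => Set.Icc (z t - (2 * C + 1)) (z t + (2 * C + 1))
  have hB : IsCompact B := isCompact_univ_pi fun t => isCompact_Icc
  have hu0 : u0 ∈ B := by
    intro t _
    simp only [u0, Set.mem_Icc]
    constructor <;> linarith
  obtain ⟨u, huB, hu⟩ := hB.exists_isMinOn ⟨u0, hu0⟩ hc.continuousOn
  refine ⟨ext u, fun t ht => by simp only [ext, dif_neg ht], ?_⟩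
  intro v hv
  let v' : Finset.Icc a b → ℝ := fun t => v t
  have hvv : windowCost β z a b v = windowCost β z a b (ext v') := by
    refine windowCost_congr _ _ _ _ _ _ fun t h1 h2 => ?_
    by_cases h : t ∈ Finset.Icc a b
    · simp only [ext, dif_pos h, v']
    · have hta : t = a - 1 := by
        rw [Finset.mem_Icc] at h
        omega
      subst hta
      rw [hv]
      simp [ext]
  rw [hvv]
  by_cases hB' : v' ∈ B
  · exact hu hB'
  · have h1 : windowCost β z a b (ext u) ≤ C := hu hu0
    refine h1.trans ?_
    simp only [B, Set.mem_pi, not_forall] at hB'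
    obtain ⟨t, _, ht⟩ := hB'
    have h2 := hlow (ext v') t t.2
    have h3 : ext v' t = v' t := by simp only [ext, dif_pos t.2]
    rw [h3] at h2
    refine le_trans ?_ h2
    rw [Set.mem_Icc, not_and_or, not_le, not_le] at ht
    rcases ht with ht | ht <;> nlinarith

theorem exists_isOpt (β : ℝ) (hβ : 0 ≤ β) (T : ℕ) (y : ℤ → ℝ) : ∃ x, IsOpt β T y x := by
  obtain ⟨v, h1, h2⟩ := exists_window_min β hβ y 1 T (fun _ => 0)
  exact ⟨v, fun t ht => h1 t (by rw [Finset.mem_Icc]; omega), h2⟩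

theorem exists_isFHC (β : ℝ) (hβ : 0 ≤ β) (w T k : ℕ) (f yhat e : ℤ → ℝ) :
    ∃ x, IsFHC β w T k f yhat e x := by
  have key : ∀ n : ℕ, ∃ x : ℤ → ℝ, (∀ t ≤ 0, x t = 0) ∧
      ∀ τ ∈ startTimes w T k, τ < -(w : ℤ) + n →
        SolvesWindow β (prediction f yhat e (τ - 1)) (max τ 1) (min (τ + w) T) x := by
    intro n
    induction n with
    | zero =>
      refine ⟨fun _ => 0, fun _ _ => rfl, fun τ hτ h => ?_⟩
      simp only [startTimes, Finset.mem_filter, Finset.mem_Icc] at hτ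
      push_cast at h
      omega
    | succ n ih =>
      obtain ⟨x, hx0, hx⟩ := ih
      set m : ℤ := -(w : ℤ) + n with hm
      by_cases hmem : m ∈ startTimes w T k
      · obtain ⟨v, h1, h2⟩ := exists_window_min β hβ (prediction f yhat e (m - 1))
          (max m 1) (min (m + w) T) x
        refine ⟨v, fun t ht => ?_, fun τ hτ h => ?_⟩
        · rw [h1 t (by rw [Finset.mem_Icc]; omega), hx0 t ht]
        · push_cast at h
          rcases eq_or_ne τ m with rfl | hne
          · exact h2
          have hlt : τ < m := by omega
          have hle : τ + w < m := by
            simp only [startTimes, Finset.mem_filter] at hτ hmem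
            have hmod : τ ≡ m [ZMOD ((w : ℤ) + 1)] := hτ.2.trans hmem.2.symm
            have hdvd := hmod.dvd
            have := Int.le_of_dvd (by omega) hdvd
            omega
          have hagree : ∀ t, t ≤ min (τ + w) T ∨ t = max τ 1 - 1 → v t = x t := by
            intro t ht
            exact h1 t (by rw [Finset.mem_Icc]; omega)
          intro u hu
          rw [windowCost_congr _ _ _ _ v x fun t _ h4 => hagree t (Or.inl h4)]
          exact hx τ hτ hlt u (by rw [hu, hagree _ (Or.inr rfl)])
      · refine ⟨x, hx0, fun τ hτ h => hx τ hτ ?_⟩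
        push_cast at h
        have : τ ≠ m := fun h' => hmem (h' ▸ hτ)
        omega
  obtain ⟨x, h0, h⟩ := key (w + T + 1)
  refine ⟨x, h0, fun τ hτ => h τ hτ ?_⟩
  simp only [startTimes, Finset.mem_filter, Finset.mem_Icc] at hτ
  push_cast
  omega

/-- The optimal dynamic offline solution `x*` (the cost is strictly convex, so it is unique on
`1, …, T`). -/
noncomputable def opt (β : ℝ) (T : ℕ) (y : ℤ → ℝ) : ℤ → ℝ :=
  Classical.epsilon (IsOpt β T y)

/-- The action sequence of the `k`-th fixed horizon control algorithm (unique on `1, …, T`). -/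
noncomputable def fhc (β : ℝ) (w T : ℕ) (f yhat e : ℤ → ℝ) (k : ℕ) : ℤ → ℝ :=
  Classical.epsilon (IsFHC β w T k f yhat e)

theorem isOpt_opt (β : ℝ) (hβ : 0 ≤ β) (T : ℕ) (y : ℤ → ℝ) : IsOpt β T y (opt β T y) :=
  Classical.epsilon_spec (exists_isOpt β hβ T y)

theorem isFHC_fhc (β : ℝ) (hβ : 0 ≤ β) (w T k : ℕ) (f yhat e : ℤ → ℝ) :
    IsFHC β w T k f yhat e (fhc β w T f yhat e k) :=
  Classical.epsilon_spec (exists_isFHC β hβ w T k f yhat e)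

/-- Averaging fixed horizon control: the average of the `w + 1` fixed horizon algorithms. -/
noncomputable def afhc (β : ℝ) (w T : ℕ) (f yhat e : ℤ → ℝ) (t : ℤ) : ℝ :=
  (1 / ((w : ℝ) + 1)) * ∑ k ∈ Finset.range (w + 1), fhc β w T f yhat e k t

/-- `cost(AFHC) - cost(OPT)` on the noise path `e`. -/
noncomputable def competitiveDifference (β : ℝ) (w T : ℕ) (f yhat e : ℤ → ℝ) : ℝ :=
  cost β T (target f yhat e) (afhc β w T f yhat e) -
    cost β T (target f yhat e) (opt β T (target f yhat e))

/-- `g₁ = 1/(w+1) ∑_k ∑_{τ ∈ Ω_k} β |x*_{τ-1} - x^{(k)}_{τ-1}|`. -/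
noncomputable def g1 (β : ℝ) (w T : ℕ) (f yhat e : ℤ → ℝ) : ℝ :=
  (1 / ((w : ℝ) + 1)) * ∑ k ∈ Finset.range (w + 1), ∑ τ ∈ startTimes w T k,
    β * |opt β T (target f yhat e) (τ - 1) - fhc β w T f yhat e k (τ - 1)|

/-- `g₂ = 1/(w+1) ∑_k ∑_{τ ∈ Ω_k} ∑_{t=τ}^{τ+w} ½ (y_t - y_{t|τ-1})²`, over slots in `1, …, T`. -/
noncomputable def g2 (w T : ℕ) (f yhat e : ℤ → ℝ) : ℝ :=
  (1 / ((w : ℝ) + 1)) * ∑ k ∈ Finset.range (w + 1), ∑ τ ∈ startTimes w T k,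
    ∑ t ∈ windowSlots w T τ, (1 / 2) * (target f yhat e t - prediction f yhat e (τ - 1) t) ^ 2

/-- The index set `{1, …, T}`. -/
abbrev Slot (T : ℕ) : Type := ↥(Finset.Icc (1 : ℤ) (T : ℤ))

/-- The block diagonal matrix `A_k`: inside each window of `Ω_k` it is the lower triangular
Toeplitz matrix with entries `f(t - s)`. -/
noncomputable def blockMatrix (w T : ℕ) (f : ℤ → ℝ) (k : ℕ) : Matrix (Slot T) (Slot T) ℝ :=
  Matrix.of fun t s =>
    if ∃ τ ∈ startTimes w T k, τ ≤ (s : ℤ) ∧ (s : ℤ) ≤ t ∧ (t : ℤ) ≤ τ + w then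
      f ((t : ℤ) - s) else 0

/-- A matrix `A` with `Aᵀ A = 1/(w+1) ∑_k A_kᵀ A_k`: the `A_k`, scaled and stacked. -/
noncomputable def stackedMatrix (w T : ℕ) (f : ℤ → ℝ) :
    Matrix (Fin (w + 1) × Slot T) (Slot T) ℝ :=
  Matrix.of fun p s => blockMatrix w T f p.1 p.2 s / Real.sqrt ((w : ℝ) + 1)

theorem stackedMatrix_transpose_mul (w T : ℕ) (f : ℤ → ℝ) :
    (stackedMatrix w T f).transpose * stackedMatrix w T f =
      (1 / ((w : ℝ) + 1)) • ∑ k ∈ Finset.range (w + 1),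
        (blockMatrix w T f k).transpose * blockMatrix w T f k := by
  ext i j
  have hs : Real.sqrt ((w : ℝ) + 1) * Real.sqrt ((w : ℝ) + 1) = (w : ℝ) + 1 :=
    Real.mul_self_sqrt (by positivity)
  simp only [Matrix.mul_apply, Matrix.transpose_apply, stackedMatrix, Matrix.of_apply,
    Fintype.sum_prod_type, Matrix.smul_apply, Matrix.sum_apply, smul_eq_mul,
    div_mul_div_comm, hs]
  rw [Finset.sum_range (fun k => ∑ x, blockMatrix w T f k x i * blockMatrix w T f k x j),
    Finset.mul_sum]
  refine Finset.sum_congr rfl fun k _ => ?_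
  rw [Finset.mul_sum]
  refine Finset.sum_congr rfl fun t _ => ?_
  ring

/-- `λ`, the largest eigenvalue of `A Aᵀ`. -/
noncomputable def topEigenvalue (w T : ℕ) (f : ℤ → ℝ) : ℝ :=
  sSup (spectrum ℝ (stackedMatrix w T f * (stackedMatrix w T f).transpose))

/-- `‖f_w‖² = σ² ∑_{s=0}^{w} f(s)²`. -/
noncomputable def fNormSq (σ : ℝ) (f : ℤ → ℝ) (w : ℕ) : ℝ :=
  σ ^ 2 * ∑ s ∈ Finset.range (w + 1), f s ^ 2

/-- `F(w) = σ² ∑_{s=0}^{w} (w - s + 1) f(s)²`. -/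
noncomputable def bigF (σ : ℝ) (f : ℤ → ℝ) (w : ℕ) : ℝ :=
  σ ^ 2 * ∑ s ∈ Finset.range (w + 1), ((w : ℝ) - s + 1) * f s ^ 2

/-- `V₁ = (3 β² + β ‖f_w‖) T / (w+1)`. -/
noncomputable def V1 (β σ : ℝ) (f : ℤ → ℝ) (w T : ℕ) : ℝ :=
  3 * β ^ 2 * T / ((w : ℝ) + 1) + β * T / ((w : ℝ) + 1) * Real.sqrt (fNormSq σ f w)

/-- `V₂ = T F(w) / (2 (w+1))`. -/
noncomputable def V2 (σ : ℝ) (f : ℤ → ℝ) (w T : ℕ) : ℝ :=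
  T / (2 * ((w : ℝ) + 1)) * bigF σ f w

end OnlineLasso

/-! A window cost is strictly convex, with unique minimisers that depend continuously on the targets
and on the boundary value. Comparing each fixed horizon algorithm with `x*` window by window costs
`β |x*_{τ-1} - x^{(k)}_{τ-1}|` at the start of a window plus the effect of replacing the true
targets by the predictions; by convexity of the cost, averaging over `k` gives
`cost(AFHC) - cost(OPT) ≤ g₁ + g₂`.

At the end of a window both `x*` and `x^{(k)}` lie close to their targets, so `g₁` is at most a
constant plus a multiple of the sum of the absolute prediction errors. That sum is Lipschitz in each
noise variable separately, and McDiarmid's inequality applies.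

The term `g₂ = ½ ‖A e‖²` has unbounded sensitivity but is self-bounding: the squares of its
one-coordinate decrements add up to at most a multiple of `g₂` itself. Tensorisation of entropy
turns this into a differential inequality for the moment generating function, and Herbst's argument
integrates it to the stated tail. -/

namespace OnlineLasso

section BoundedMeasurable

variable {α γ : Type*} [MeasurableSpace α] [MeasurableSpace γ]

/-- Bounded measurable functions: a class of functions integrable against every finite measure and
stable under sums, products, exponentials and partial integration. -/
structure IsBddMeasurable (f : α → ℝ) : Prop where
  measurable : Measurable f
  bdd : ∃ C, ∀ a, |f a| ≤ C

namespace IsBddMeasurable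

variable {f g : α → ℝ}

theorem integrable (hf : IsBddMeasurable f) (μ : Measure α) [IsFiniteMeasure μ] :
    Integrable f μ :=
  let ⟨C, hC⟩ := hf.bdd
  Integrable.of_bound hf.measurable.aestronglyMeasurable C (ae_of_all _ hC)

theorem const (c : ℝ) : IsBddMeasurable fun _ : α => c :=
  ⟨measurable_const, |c|, fun _ => le_rfl⟩

theorem comp (hf : IsBddMeasurable f) {φ : γ → α} (hφ : Measurable φ) :
    IsBddMeasurable fun c => f (φ c) :=
  ⟨hf.measurable.comp hφ, hf.bdd.imp fun _ hC c => hC (φ c)⟩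

theorem add (hf : IsBddMeasurable f) (hg : IsBddMeasurable g) :
    IsBddMeasurable fun a => f a + g a :=
  let ⟨C, hC⟩ := hf.bdd
  let ⟨D, hD⟩ := hg.bdd
  ⟨hf.measurable.add hg.measurable, C + D, fun a =>
    (abs_add_le _ _).trans (add_le_add (hC a) (hD a))⟩

theorem mul (hf : IsBddMeasurable f) (hg : IsBddMeasurable g) :
    IsBddMeasurable fun a => f a * g a :=
  let ⟨C, hC⟩ := hf.bdd
  let ⟨D, hD⟩ := hg.bdd
  ⟨hf.measurable.mul hg.measurable, C * D, fun a => (abs_mul _ _).trans_le <|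
    mul_le_mul (hC a) (hD a) (abs_nonneg _) ((abs_nonneg _).trans (hC a))⟩

theorem const_mul (hf : IsBddMeasurable f) (c : ℝ) : IsBddMeasurable fun a => c * f a :=
  (const c).mul hf

theorem sub (hf : IsBddMeasurable f) (hg : IsBddMeasurable g) :
    IsBddMeasurable fun a => f a - g a := by
  simpa only [neg_one_mul, ← sub_eq_add_neg] using hf.add (hg.const_mul (-1))

theorem sum {ι : Type*} {s : Finset ι} {f : ι → α → ℝ} (hf : ∀ i ∈ s, IsBddMeasurable (f i)) :
    IsBddMeasurable fun a => ∑ i ∈ s, f i a := by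
  choose! C hC using fun i (hi : i ∈ s) => (hf i hi).bdd
  exact ⟨Finset.measurable_fun_sum _ fun i hi => (hf i hi).measurable, ∑ i ∈ s, C i, fun a =>
    (Finset.abs_sum_le_sum_abs _ _).trans (Finset.sum_le_sum fun i hi => hC i hi a)⟩

theorem exp (hf : IsBddMeasurable f) : IsBddMeasurable fun a => Real.exp (f a) :=
  let ⟨C, hC⟩ := hf.bdd
  ⟨hf.measurable.exp, Real.exp C, fun a => by
    rw [Real.abs_exp]
    exact Real.exp_le_exp.2 ((le_abs_self _).trans (hC a))⟩

theorem integral_exp_pos (hf : IsBddMeasurable f) (μ : Measure α) [IsProbabilityMeasure μ] :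
    0 < ∫ a, Real.exp (f a) ∂μ :=
  MeasureTheory.integral_exp_pos (hf.exp.integrable μ)

theorem abs_log_integral_exp_le (hf : IsBddMeasurable f) (μ : Measure α)
    [IsProbabilityMeasure μ] {C : ℝ} (hC : ∀ a, |f a| ≤ C) :
    |Real.log (∫ a, Real.exp (f a) ∂μ)| ≤ C := by
  have hpos := hf.integral_exp_pos μ
  have hint := hf.exp.integrable μ
  rw [abs_le, Real.le_log_iff_exp_le hpos, Real.log_le_iff_le_exp hpos]
  constructor
  · simpa using integral_mono (integrable_const (Real.exp (-C))) hint fun a =>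
      Real.exp_le_exp.2 (abs_le.1 (hC a)).1
  · simpa using integral_mono hint (integrable_const (Real.exp C)) fun a =>
      Real.exp_le_exp.2 (abs_le.1 (hC a)).2

theorem integral_right {f : γ × α → ℝ} (hf : IsBddMeasurable f) (μ : Measure α)
    [IsProbabilityMeasure μ] : IsBddMeasurable fun c => ∫ a, f (c, a) ∂μ := by
  obtain ⟨C, hC⟩ := hf.bdd
  refine ⟨hf.measurable.stronglyMeasurable.integral_prod_right'.measurable, C, fun c => ?_⟩
  simpa using norm_integral_le_of_norm_le_const (μ := μ) (f := fun a => f (c, a))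
    (ae_of_all _ fun a => hC (c, a))

theorem integral_left {f : α × γ → ℝ} (hf : IsBddMeasurable f) (μ : Measure α)
    [IsProbabilityMeasure μ] : IsBddMeasurable fun c => ∫ a, f (a, c) ∂μ :=
  (hf.comp measurable_swap).integral_right μ

theorem log_integral_exp {f : γ × α → ℝ} (hf : IsBddMeasurable f) (μ : Measure α)
    [IsProbabilityMeasure μ] :
    IsBddMeasurable fun c => Real.log (∫ a, Real.exp (f (c, a)) ∂μ) :=
  let ⟨C, hC⟩ := hf.bdd
  ⟨(hf.exp.integral_right μ).measurable.log, C, fun c =>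
    (hf.comp measurable_prodMk_left).abs_log_integral_exp_le μ fun a => hC (c, a)⟩

end IsBddMeasurable

end BoundedMeasurable

section Entropy

variable {α γ : Type*} [MeasurableSpace α] [MeasurableSpace γ]

/-- The entropy `𝔼[e^y log e^y] - 𝔼[e^y] log 𝔼[e^y]` of `exp y` under `μ`. -/
noncomputable def expEntropy (μ : Measure α) (y : α → ℝ) : ℝ :=
  ∫ a, y a * Real.exp (y a) ∂μ - (∫ a, Real.exp (y a) ∂μ) * Real.log (∫ a, Real.exp (y a) ∂μ)

theorem IsBddMeasurable.expEntropy {y : γ × α → ℝ} (hy : IsBddMeasurable y) (ν : Measure α)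
    [IsProbabilityMeasure ν] : IsBddMeasurable fun c => expEntropy ν fun a => y (c, a) :=
  ((hy.mul hy.exp).integral_right ν).sub ((hy.exp.integral_right ν).mul (hy.log_integral_exp ν))

variable (μ : Measure α) [IsProbabilityMeasure μ] (ν : Measure γ) [IsProbabilityMeasure ν]

/- Gibbs' variational principle, from `exp u * (v' - u) ≤ exp v' - exp u`, where `v'` is `v`
shifted so that the right-hand side has integral zero. -/
theorem integral_exp_mul_sub_le_expEntropy {u v : α → ℝ} (hu : IsBddMeasurable u)
    (hv : IsBddMeasurable v) :
    ∫ a, Real.exp (u a) * v a ∂μ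
      - (∫ a, Real.exp (u a) ∂μ) * Real.log (∫ a, Real.exp (v a) ∂μ) ≤ expEntropy μ u := by
  have hupos := hu.integral_exp_pos μ
  have hvpos := hv.integral_exp_pos μ
  set p := ∫ a, Real.exp (u a) ∂μ with hp
  set q := ∫ a, Real.exp (v a) ∂μ with hq
  have hpointwise : ∀ a, Real.exp (u a) * v a - u a * Real.exp (u a)
      - (Real.log q - Real.log p) * Real.exp (u a) ≤ p / q * Real.exp (v a) - Real.exp (u a) := by
    intro a
    have hlin := Real.add_one_le_exp (v a + (Real.log p - Real.log q) - u a)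
    have hexp : Real.exp (v a + (Real.log p - Real.log q) - u a) * Real.exp (u a) =
        p / q * Real.exp (v a) := by
      rw [← Real.exp_add, sub_add_cancel, Real.exp_add, Real.exp_sub, Real.exp_log hupos,
        Real.exp_log hvpos, mul_comm]
    linarith [mul_le_mul_of_nonneg_right hlin (Real.exp_pos (u a)).le]
  have huv := hu.exp.mul hv
  have huu := hu.mul hu.exp
  have hmono := integral_mono (((huv.sub huu).sub (hu.exp.const_mul _)).integrable μ)
    (((hv.exp.const_mul _).sub hu.exp).integrable μ) hpointwise
  rw [integral_sub ((huv.sub huu).integrable μ) ((hu.exp.const_mul _).integrable μ),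
    integral_sub ((hv.exp.const_mul _).integrable μ) (hu.exp.integrable μ), integral_const_mul,
    integral_const_mul, integral_sub (huv.integrable μ) (huu.integrable μ), ← hp, ← hq,
    div_mul_cancel₀ _ hvpos.ne', sub_self] at hmono
  rw [expEntropy, ← hp]
  linarith

theorem expEntropy_prod_eq {y : α × γ → ℝ} (hy : IsBddMeasurable y) :
    expEntropy (μ.prod ν) y = ∫ a, expEntropy ν (fun b => y (a, b)) ∂μ
      + expEntropy μ (fun a => Real.log (∫ b, Real.exp (y (a, b)) ∂ν)) := by
  have hpos : ∀ a, 0 < ∫ b, Real.exp (y (a, b)) ∂ν := fun a =>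
    (hy.comp measurable_prodMk_left).integral_exp_pos ν
  simp only [expEntropy, Real.exp_log (hpos _)]
  rw [integral_prod _ ((hy.mul hy.exp).integrable _), integral_prod _ (hy.exp.integrable _),
    integral_sub (((hy.mul hy.exp).integral_right ν).integrable μ)
      (((hy.exp.integral_right ν).mul (hy.log_integral_exp ν)).integrable μ)]
  simp only [mul_comm (∫ b, Real.exp (y (_, b)) ∂ν)]
  ring

theorem expEntropy_log_integral_exp_le {y : α × γ → ℝ} (hy : IsBddMeasurable y) :
    expEntropy μ (fun a => Real.log (∫ b, Real.exp (y (a, b)) ∂ν)) ≤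
      ∫ b, expEntropy μ (fun a => y (a, b)) ∂ν := by
  set v : α → ℝ := fun a => Real.log (∫ b, Real.exp (y (a, b)) ∂ν)
  have hvb : IsBddMeasurable v := hy.log_integral_exp ν
  have hexpv : ∀ a, Real.exp (v a) = ∫ b, Real.exp (y (a, b)) ∂ν := fun a =>
    Real.exp_log ((hy.comp measurable_prodMk_left).integral_exp_pos ν)
  have hyv := hy.exp.mul (hvb.comp measurable_fst)
  set logm := Real.log (∫ a, Real.exp (v a) ∂μ) with hlogm
  have hmono := integral_mono
    (((hyv.integral_left μ).sub ((hy.exp.integral_left μ).mul (.const logm))).integrable ν)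
    (((hy.comp measurable_swap).expEntropy μ).integrable ν)
    fun b => integral_exp_mul_sub_le_expEntropy μ (hy.comp measurable_prodMk_right) hvb
  refine Eq.trans_le ?_ hmono
  rw [integral_sub ((hyv.integral_left μ).integrable ν)
    (((hy.exp.integral_left μ).mul (.const logm)).integrable ν), integral_mul_const,
    ← integral_prod_symm _ (hyv.integrable _), ← integral_prod_symm _ (hy.exp.integrable _),
    integral_prod _ (hyv.integrable _), integral_prod _ (hy.exp.integrable _)]
  simp only [integral_mul_const, ← hexpv, expEntropy, mul_comm, hlogm]

theorem expEntropy_prod_le {y : α × γ → ℝ} (hy : IsBddMeasurable y) :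
    expEntropy (μ.prod ν) y ≤ ∫ a, expEntropy ν (fun b => y (a, b)) ∂μ
      + ∫ b, expEntropy μ (fun a => y (a, b)) ∂ν :=
  (expEntropy_prod_eq μ ν hy).trans_le
    (add_le_add_right (expEntropy_log_integral_exp_le μ ν hy) _)

end Entropy

section Product

variable {ι K : Type*} [MeasurableSpace K]

theorem measurePreserving_update [Fintype ι] [DecidableEq ι] (ν : ι → Measure K)
    [∀ i, IsProbabilityMeasure (ν i)] (i : ι) :
    MeasurePreserving (fun p : (ι → K) × K => Function.update p.1 i p.2)
      ((Measure.pi ν).prod (ν i)) (Measure.pi ν) := by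
  have hmeas : Measurable fun p : (ι → K) × K => Function.update p.1 i p.2 := by fun_prop
  refine ⟨hmeas, (Measure.pi_eq fun s hs => ?_).symm⟩
  have hpreimage : (fun p : (ι → K) × K => Function.update p.1 i p.2) ⁻¹' Set.univ.pi s =
      Set.univ.pi (Function.update s i Set.univ) ×ˢ s i := by
    ext ⟨x, r⟩
    simp only [Set.mem_preimage, Set.mem_univ_pi, Set.mem_prod]
    refine ⟨fun h => ⟨fun j => ?_, by simpa using h i⟩, fun h j => ?_⟩
    · rcases eq_or_ne j i with rfl | hj
      · simp
      · simpa [hj] using h j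
    · rcases eq_or_ne j i with rfl | hj
      · simpa using h.2
      · simpa [hj] using h.1 j
  rw [Measure.map_apply hmeas (MeasurableSet.univ_pi hs), hpreimage, Measure.prod_prod,
    Measure.pi_pi, ← Finset.mul_prod_erase _ _ (Finset.mem_univ i),
    ← Finset.mul_prod_erase _ (fun j => ν j (s j)) (Finset.mem_univ i), mul_comm]
  simp only [Function.update_self, measure_univ, one_mul]
  congr 1
  exact Finset.prod_congr rfl fun j hj => by
    rw [Function.update_of_ne (Finset.ne_of_mem_erase hj)]

theorem integral_integral_update [Fintype ι] [DecidableEq ι] (ν : ι → Measure K)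
    [∀ i, IsProbabilityMeasure (ν i)] (i : ι) {f : (ι → K) → ℝ} (hf : IsBddMeasurable f) :
    ∫ x, ∫ r, f (Function.update x i r) ∂(ν i) ∂(Measure.pi ν) = ∫ x, f x ∂(Measure.pi ν) := by
  have h := measurePreserving_update ν i
  rw [← h.map_eq, integral_map h.measurable.aemeasurable hf.measurable.aestronglyMeasurable,
    integral_prod _ ((hf.comp h.measurable).integrable _), h.map_eq]

variable {n : ℕ} (ν : Fin (n + 1) → Measure K) [∀ i, IsProbabilityMeasure (ν i)]

theorem integral_pi_succ (f : (Fin (n + 1) → K) → ℝ) :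
    ∫ x, f x ∂(Measure.pi ν) =
      ∫ p, f (Fin.cons p.1 p.2) ∂((ν 0).prod (Measure.pi fun j => ν j.succ)) := by
  rw [← (measurePreserving_piFinSuccAbove ν 0).symm.integral_comp' f]
  simp only [MeasurableEquiv.piFinSuccAbove_symm_apply, Fin.insertNthEquiv, Equiv.coe_fn_mk,
    Fin.insertNth_zero, Fin.zero_succAbove, cast_eq]

theorem measurable_finCons :
    Measurable fun p : K × (Fin n → K) => (Fin.cons p.1 p.2 : Fin (n + 1) → K) :=
  measurable_pi_lambda _ fun i => by
    cases i using Fin.cases with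
    | zero => exact measurable_fst
    | succ j => exact (measurable_pi_apply j).comp measurable_snd

theorem expEntropy_pi_succ (y : (Fin (n + 1) → K) → ℝ) :
    expEntropy (Measure.pi ν) y = expEntropy
      ((ν 0).prod (Measure.pi fun j => ν j.succ)) (fun p => y (Fin.cons p.1 p.2)) := by
  rw [expEntropy, integral_pi_succ ν (fun x => y x * Real.exp (y x)),
    integral_pi_succ ν (fun x => Real.exp (y x)), expEntropy]

theorem IsBddMeasurable.expEntropy_update {ι : Type*} [DecidableEq ι] {y : (ι → K) → ℝ}
    (hy : IsBddMeasurable y) (i : ι) (ν : Measure K) [IsProbabilityMeasure ν] :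
    IsBddMeasurable fun x => OnlineLasso.expEntropy ν fun r => y (Function.update x i r) :=
  (hy.comp (φ := fun p : (ι → K) × K => Function.update p.1 i p.2) (by fun_prop)).expEntropy ν

theorem expEntropy_pi_fin_le {n : ℕ} (ν : Fin n → Measure K) [∀ i, IsProbabilityMeasure (ν i)]
    {y : (Fin n → K) → ℝ} (hy : IsBddMeasurable y) :
    expEntropy (Measure.pi ν) y ≤
      ∑ i, ∫ x, expEntropy (ν i) (fun r => y (Function.update x i r)) ∂(Measure.pi ν) := by
  induction n with
  | zero =>
    rw [Measure.pi_of_empty ν]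
    simp [expEntropy, mul_comm]
  | succ n ih =>
    set π := Measure.pi fun j : Fin n => ν j.succ
    have hcons := hy.comp measurable_finCons
    have hent : ∀ i, IsBddMeasurable fun p : K × (Fin n → K) =>
        expEntropy (ν i) fun r => y (Function.update (Fin.cons p.1 p.2) i r) := fun i =>
      (hy.expEntropy_update i (ν i)).comp measurable_finCons
    have htail : ∀ a, expEntropy π (fun b => y (Fin.cons a b)) ≤
        ∑ i : Fin n, ∫ b, expEntropy (ν i.succ)
          (fun r => y (Function.update (Fin.cons a b) i.succ r)) ∂π := fun a => by
      simpa only [Fin.cons_update] using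
        ih (fun j => ν j.succ) (hcons.comp (measurable_prodMk_left (x := a)))
    have hhead : ∫ b, expEntropy (ν 0) (fun a => y (Fin.cons a b)) ∂π =
        ∫ p, expEntropy (ν 0) (fun r => y (Function.update (Fin.cons p.1 p.2) 0 r))
          ∂((ν 0).prod π) := by
      simp only [Fin.update_cons_zero]
      rw [integral_fun_snd (fun b => expEntropy (ν 0) fun a => y (Fin.cons a b)), probReal_univ,
        one_smul]
    rw [expEntropy_pi_succ, Fin.sum_univ_succ]
    simp only [integral_pi_succ ν]
    refine (expEntropy_prod_le (ν 0) π hcons).trans ?_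
    rw [add_comm, hhead]
    gcongr
    refine (integral_mono ((hcons.expEntropy π).integrable _) ((IsBddMeasurable.sum fun i _ =>
      (hent (Fin.succ i)).integral_right π).integrable _) htail).trans_eq ?_
    rw [integral_finsetSum _ fun i _ => ((hent _).integral_right π).integrable _]
    exact Finset.sum_congr rfl fun i _ => (integral_prod _ ((hent _).integrable _)).symm

variable [Fintype ι]

theorem integral_pi_eq_comp_equiv (q : ι ≃ Fin n) (ν : ι → Measure K)
    [∀ i, IsProbabilityMeasure (ν i)] (f : (ι → K) → ℝ) :
    ∫ x, f x ∂(Measure.pi ν) =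
      ∫ x, f (x ∘ q) ∂(Measure.pi fun j => ν (q.symm j)) :=
  ((measurePreserving_arrowCongr' (fun j => ν (q.symm j)) ν q.symm (MeasurableEquiv.refl K)
    fun j => MeasurePreserving.id (ν (q.symm j))).integral_comp' f).symm

theorem expEntropy_pi_le [DecidableEq ι] (ν : ι → Measure K) [∀ i, IsProbabilityMeasure (ν i)]
    {y : (ι → K) → ℝ} (hy : IsBddMeasurable y) :
    expEntropy (Measure.pi ν) y ≤
      ∑ i, ∫ x, expEntropy (ν i) (fun r => y (Function.update x i r)) ∂(Measure.pi ν) := by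
  set q := Fintype.equivFin ι
  have hcomp : Measurable fun x : Fin _ → K => x ∘ q := by fun_prop
  have hfin := expEntropy_pi_fin_le (fun j => ν (q.symm j)) (hy.comp hcomp)
  simp only [Function.update_comp_equiv] at hfin
  rw [← Equiv.sum_comp q.symm]
  simpa only [expEntropy, integral_pi_eq_comp_equiv q ν] using hfin

end Product

section OneCoordinate

variable {α : Type*} [MeasurableSpace α] (ν : Measure α) [IsProbabilityMeasure ν]

theorem integral_prod_sub_mul_sub {y g : α → ℝ} (hy : IsBddMeasurable y)
    (hg : IsBddMeasurable g) :
    ∫ p, (y p.1 - y p.2) * (g p.1 - g p.2) ∂(ν.prod ν) =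
      2 * (∫ a, y a * g a ∂ν - (∫ a, y a ∂ν) * ∫ a, g a ∂ν) := by
  have hfst {f : α → ℝ} (hf : IsBddMeasurable f) := hf.comp (measurable_fst (α := α) (β := α))
  have hsnd {f : α → ℝ} (hf : IsBddMeasurable f) := hf.comp (measurable_snd (α := α) (β := α))
  have hexpand : ∀ p : α × α, (y p.1 - y p.2) * (g p.1 - g p.2) =
      (y p.1 * g p.1 + y p.2 * g p.2) - (y p.1 * g p.2 + g p.1 * y p.2) := fun p => by ring
  have h11 := hfst (hy.mul hg)
  have h22 := hsnd (hy.mul hg)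
  have h12 := (hfst hy).mul (hsnd hg)
  have h21 := (hfst hg).mul (hsnd hy)
  simp only [hexpand]
  rw [integral_sub ((h11.add h22).integrable _) ((h12.add h21).integrable _),
    integral_add (h11.integrable _) (h22.integrable _),
    integral_add (h12.integrable _) (h21.integrable _),
    integral_prod_mul y g, integral_prod_mul g y, integral_fun_fst (fun a => y a * g a),
    integral_fun_snd (fun a => y a * g a), probReal_univ, one_smul]
  ring

theorem expEntropy_le_covariance {y : α → ℝ} (hy : IsBddMeasurable y) :
    expEntropy ν y ≤ ∫ a, y a * Real.exp (y a) ∂ν - (∫ a, y a ∂ν) * ∫ a, Real.exp (y a) ∂ν := by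
  have hpos := hy.integral_exp_pos ν
  have hjensen : ∫ a, y a ∂ν ≤ Real.log (∫ a, Real.exp (y a) ∂ν) := by
    rw [Real.le_log_iff_exp_le hpos]
    exact convexOn_exp.map_integral_le Real.continuous_exp.continuousOn isClosed_univ
      (by simp) (hy.integrable ν) (hy.exp.integrable ν)
  rw [expEntropy]
  linarith [mul_le_mul_of_nonneg_left hjensen hpos.le]

theorem sub_mul_exp_sub_exp_le {s t : ℝ} (hts : t ≤ s) :
    (s - t) * (Real.exp s - Real.exp t) ≤ (s - t) ^ 2 * Real.exp s := by
  have hexp : Real.exp s - Real.exp t ≤ (s - t) * Real.exp s := by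
    have hsplit : Real.exp t = Real.exp (t - s) * Real.exp s := by
      rw [← Real.exp_add, sub_add_cancel]
    linarith [mul_le_mul_of_nonneg_right (Real.add_one_le_exp (t - s)) (Real.exp_pos s).le]
  linarith [mul_le_mul_of_nonneg_left hexp (sub_nonneg.2 hts)]

theorem sub_mul_exp_sub_exp_le_add {s t p q : ℝ} (hp : s - t ≤ p) (hq : t - s ≤ q) :
    (s - t) * (Real.exp s - Real.exp t) ≤ p ^ 2 * Real.exp s + q ^ 2 * Real.exp t := by
  have hordered : ∀ {s t p : ℝ}, s - t ≤ p → t ≤ s →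
      (s - t) * (Real.exp s - Real.exp t) ≤ p ^ 2 * Real.exp s := fun hp hts =>
    (sub_mul_exp_sub_exp_le hts).trans <| mul_le_mul_of_nonneg_right
      (pow_le_pow_left₀ (sub_nonneg.2 hts) hp 2) (Real.exp_pos _).le
  rcases le_total t s with hts | hst
  · exact (hordered hp hts).trans (le_add_of_nonneg_right (by positivity))
  · rw [← neg_sub t s, ← neg_sub (Real.exp t), neg_mul_neg]
    exact (hordered hq hst).trans (le_add_of_nonneg_left (by positivity))

theorem integral_sub_sq_le {c : α → ℝ} (hc : Measurable c) {ε : ℝ} (hε : ∀ a, |c a| ≤ ε)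
    (hc₀ : ∫ a, c a ∂ν = 0) {r : ℝ} (hr : |r| ≤ ε) : ∫ a, (r - c a) ^ 2 ∂ν ≤ 2 * ε ^ 2 := by
  have hcb : IsBddMeasurable c := ⟨hc, ε, hε⟩
  have hbound : ∀ a, (r - c a) ^ 2 ≤ 2 * ε ^ 2 - 2 * r * c a := fun a => by
    linarith [sq_le_sq' (abs_le.1 hr).1 (abs_le.1 hr).2,
      sq_le_sq' (abs_le.1 (hε a)).1 (abs_le.1 (hε a)).2]
  have hsq : Integrable (fun a => (r - c a) ^ 2) ν := by
    simpa only [pow_two] using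
      (((IsBddMeasurable.const r).sub hcb).mul ((IsBddMeasurable.const r).sub hcb)).integrable ν
  refine (integral_mono hsq (((IsBddMeasurable.const _).sub (hcb.const_mul _)).integrable ν)
    hbound).trans_eq ?_
  rw [integral_sub (integrable_const _) ((hcb.const_mul _).integrable ν),
    integral_const_mul (2 * r), hc₀]
  simp

/- Symmetrisation: the covariance of `y` and `exp y` is half the integral of
`(y a - y b) * (exp (y a) - exp (y b))` over independent `a` and `b`, and each such product is
bounded through the slope at the larger of the two values. -/
theorem expEntropy_le_integral_sq_mul_exp {c y d : α → ℝ} (hc : Measurable c)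
    (hy : IsBddMeasurable y) (hd : IsBddMeasurable d) {ε : ℝ} (hε : ∀ a, |c a| ≤ ε)
    (hc₀ : ∫ a, c a ∂ν = 0) (hslope : ∀ a b, y a - y b ≤ d a * (c a - c b)) :
    expEntropy ν y ≤ ∫ a, 2 * ε ^ 2 * (d a ^ 2 * Real.exp (y a)) ∂ν := by
  have hcb : IsBddMeasurable c := ⟨hc, ε, hε⟩
  have hde : IsBddMeasurable fun a => d a ^ 2 * Real.exp (y a) := by
    simpa only [pow_two] using (hd.mul hd).mul hy.exp
  set J : α × α → ℝ := fun p => d p.1 ^ 2 * Real.exp (y p.1) * (c p.1 - c p.2) ^ 2 with hJ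
  have hcc := (hcb.comp measurable_fst).sub (hcb.comp (measurable_snd (α := α)))
  have hJb : IsBddMeasurable J := by
    simpa only [pow_two, hJ] using (hde.comp measurable_fst).mul (hcc.mul hcc)
  have hsymm : ∀ p : α × α,
      (y p.1 - y p.2) * (Real.exp (y p.1) - Real.exp (y p.2)) ≤ J p + J p.swap := fun p =>
    (sub_mul_exp_sub_exp_le_add (hslope p.1 p.2) (hslope p.2 p.1)).trans_eq (by
      simp only [hJ, Prod.fst_swap, Prod.snd_swap]
      ring)
  have hcov := integral_mono
    ((((hy.comp measurable_fst).sub (hy.comp measurable_snd)).mul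
      ((hy.exp.comp measurable_fst).sub (hy.exp.comp measurable_snd))).integrable (ν.prod ν))
    ((hJb.add (hJb.comp measurable_swap)).integrable _) hsymm
  rw [integral_prod_sub_mul_sub ν hy hy.exp, integral_add (hJb.integrable _)
    ((hJb.comp measurable_swap).integrable _), integral_prod_swap J] at hcov
  have hinner : ∀ a, ∫ b, J (a, b) ∂ν ≤ 2 * ε ^ 2 * (d a ^ 2 * Real.exp (y a)) := fun a => by
    simp only [hJ]
    rw [integral_const_mul, mul_comm (2 * ε ^ 2)]
    gcongr
    exact integral_sub_sq_le ν hc hε hc₀ (hε a)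
  calc expEntropy ν y
      ≤ ∫ p, J p ∂(ν.prod ν) := by linarith [expEntropy_le_covariance ν hy]
    _ = ∫ a, ∫ b, J (a, b) ∂ν ∂ν := integral_prod _ (hJb.integrable _)
    _ ≤ _ := integral_mono ((hJb.integral_right ν).integrable ν)
      ((hde.const_mul _).integrable ν) hinner

end OneCoordinate

section BoundedDifferences

variable {ι K : Type*} [DecidableEq ι] {y : (ι → K) → ℝ} {c : ι → ℝ}

theorem abs_sub_le_sum_of_abs_sub_update_le [Fintype ι]
    (h : ∀ i x r, |y x - y (Function.update x i r)| ≤ c i) (x x' : ι → K) :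
    |y x - y x'| ≤ ∑ i, c i := by
  have hpiecewise : ∀ s : Finset ι, |y x - y (s.piecewise x' x)| ≤ ∑ i ∈ s, c i := by
    intro s
    induction s using Finset.induction_on with
    | empty => simp
    | insert i s hi ih =>
      rw [Finset.piecewise_insert, Finset.sum_insert hi, add_comm]
      exact (abs_sub_le _ (y (s.piecewise x' x)) _).trans (add_le_add ih (h i _ _))
  simpa using hpiecewise Finset.univ

theorem isBddMeasurable_of_abs_sub_update_le [Finite ι] [MeasurableSpace K] (hy : Measurable y)
    (h : ∀ i x r, |y x - y (Function.update x i r)| ≤ c i) : IsBddMeasurable y := by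
  have := Fintype.ofFinite ι
  refine ⟨hy, ?_⟩
  rcases isEmpty_or_nonempty (ι → K) with hempty | ⟨⟨x₀⟩⟩
  · exact ⟨0, hempty.elim⟩
  · refine ⟨∑ i, c i + |y x₀|, fun x => ?_⟩
    linarith [abs_sub_abs_le_abs_sub (y x) (y x₀), abs_sub_le_sum_of_abs_sub_update_le h x x₀]

end BoundedDifferences

section Clip

/-- Truncation of a real number to `[-ε, ε]`; it turns almost surely bounded variables into
bounded ones without changing them almost surely. -/
noncomputable def clip (ε r : ℝ) : ℝ := max (-ε) (min ε r)

variable {ε r : ℝ}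

theorem abs_clip_le (hε : 0 ≤ ε) : |clip ε r| ≤ ε :=
  abs_le.2 ⟨le_max_left _ _, max_le (neg_le_self hε) (min_le_left _ _)⟩

theorem clip_of_abs_le (h : |r| ≤ ε) : clip ε r = r := by
  rw [clip, min_eq_right (abs_le.1 h).2, max_eq_right (abs_le.1 h).1]

theorem measurable_clip : Measurable (clip ε) :=
  measurable_const.max (measurable_const.min measurable_id)

theorem ae_clip_eq {ι Ω : Type*} [Countable ι] [MeasurableSpace Ω] {μ : Measure Ω}
    {X : ι → Ω → ℝ} (hX : ∀ i, ∀ᵐ ω ∂μ, |X i ω| ≤ ε) :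
    (fun ω i => clip ε (X i ω)) =ᵐ[μ] fun ω i => X i ω := by
  filter_upwards [ae_all_iff.2 hX] with ω hω
  exact funext fun i => clip_of_abs_le (hω i)

end Clip

section McDiarmid

variable {K : Type*} [MeasurableSpace K]

theorem integral_exp_le_of_abs_sub_le (ν : Measure K) [IsProbabilityMeasure ν] {y : K → ℝ}
    (hy : Measurable y) {c : ℝ} (h : ∀ a b, |y a - y b| ≤ c) :
    ∫ a, Real.exp (y a) ∂ν ≤ Real.exp (∫ a, y a ∂ν + c ^ 2 / 8) := by
  have : Nonempty K := nonempty_of_isProbabilityMeasure ν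
  let a₀ := Classical.arbitrary K
  have hbdd : BddBelow (Set.range y) := ⟨y a₀ - c, by
    rintro _ ⟨a, rfl⟩
    linarith [(abs_le.1 (h a₀ a)).2]⟩
  have hmem : ∀ a, y a ∈ Set.Icc (⨅ b, y b) ((⨅ b, y b) + c) := fun a =>
    ⟨ciInf_le hbdd a, sub_le_iff_le_add.1 (le_ciInf fun b => by linarith [(abs_le.1 (h a b)).2])⟩
  have hmgf := (hasSubgaussianMGF_of_mem_Icc (μ := ν) hy.aemeasurable (ae_of_all _ hmem)).mgf_le 1
  simp only [mgf, one_mul, Real.exp_sub, integral_div] at hmgf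
  rw [div_le_iff₀ (Real.exp_pos _), ← Real.exp_add] at hmgf
  refine hmgf.trans_eq (congrArg Real.exp ?_)
  have hc : 0 ≤ c := (abs_nonneg _).trans (h a₀ a₀)
  push_cast
  rw [add_sub_cancel_left, Real.norm_of_nonneg hc]
  ring

theorem integral_exp_pi_fin_le {n : ℕ} (ν : Fin n → Measure K) [∀ i, IsProbabilityMeasure (ν i)]
    {y : (Fin n → K) → ℝ} (hy : Measurable y) {c : Fin n → ℝ}
    (h : ∀ i x r, |y x - y (Function.update x i r)| ≤ c i) :
    ∫ x, Real.exp (y x) ∂(Measure.pi ν) ≤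
      Real.exp (∫ x, y x ∂(Measure.pi ν) + (∑ i, c i ^ 2) / 8) := by
  induction n with
  | zero =>
    rw [Measure.pi_of_empty ν]
    simp
  | succ n ih =>
    set π := Measure.pi fun j : Fin n => ν j.succ with hπ
    have hcons := (isBddMeasurable_of_abs_sub_update_le hy h).comp measurable_finCons
    have hsection : ∀ a, IsBddMeasurable fun b : Fin n → K => y (Fin.cons a b) := fun a =>
      hcons.comp (measurable_prodMk_left (x := a))
    set g : K → ℝ := fun a => ∫ b, y (Fin.cons a b) ∂π
    have hg : IsBddMeasurable g := hcons.integral_right π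
    set S := ∑ i : Fin n, c i.succ ^ 2
    have htail : ∀ a, ∫ b, Real.exp (y (Fin.cons a b)) ∂π ≤ Real.exp (g a) * Real.exp (S / 8) :=
      fun a => by
        rw [← Real.exp_add]
        refine ih (fun j => ν j.succ) (hsection a).measurable fun i x r => ?_
        simpa only [Fin.cons_update] using h i.succ (Fin.cons a x) r
    have hosc : ∀ a a', |g a - g a'| ≤ c 0 := fun a a' => by
      rw [← integral_sub ((hsection a).integrable π) ((hsection a').integrable π)]
      simpa using norm_integral_le_of_norm_le_const (μ := π)
        (f := fun b => y (Fin.cons a b) - y (Fin.cons a' b)) (ae_of_all _ fun b => by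
          simpa only [Fin.update_cons_zero, Real.norm_eq_abs] using h 0 (Fin.cons a b) a')
    rw [integral_pi_succ ν (fun x => Real.exp (y x)), integral_pi_succ ν y, ← hπ,
      integral_prod _ (hcons.exp.integrable _), integral_prod _ (hcons.integrable _),
      Fin.sum_univ_succ]
    calc _ ≤ ∫ a, Real.exp (g a) * Real.exp (S / 8) ∂(ν 0) :=
          integral_mono ((hcons.exp.integral_right π).integrable _)
            ((hg.exp.mul (.const _)).integrable _) htail
      _ = (∫ a, Real.exp (g a) ∂(ν 0)) * Real.exp (S / 8) := integral_mul_const _ _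
      _ ≤ Real.exp (∫ a, g a ∂(ν 0) + c 0 ^ 2 / 8) * Real.exp (S / 8) := by
          gcongr
          exact integral_exp_le_of_abs_sub_le (ν 0) hg.measurable hosc
      _ = _ := by
          rw [← Real.exp_add, add_div, add_assoc]

variable {ι : Type*} [Fintype ι] [DecidableEq ι]

theorem integral_exp_pi_le (ν : ι → Measure K) [∀ i, IsProbabilityMeasure (ν i)]
    {y : (ι → K) → ℝ} (hy : Measurable y) {c : ι → ℝ}
    (h : ∀ i x r, |y x - y (Function.update x i r)| ≤ c i) :
    ∫ x, Real.exp (y x) ∂(Measure.pi ν) ≤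
      Real.exp (∫ x, y x ∂(Measure.pi ν) + (∑ i, c i ^ 2) / 8) := by
  set q := Fintype.equivFin ι
  have hcomp : Measurable fun x : Fin _ → K => x ∘ q := by fun_prop
  have hfin := integral_exp_pi_fin_le (fun j => ν (q.symm j)) (hy.comp hcomp)
    (c := fun j => c (q.symm j)) fun j x r => by
      simpa only [Function.comp_apply, Function.update_comp_equiv] using h (q.symm j) (x ∘ q) r
  rw [Equiv.sum_comp q.symm fun i => c i ^ 2] at hfin
  rw [integral_pi_eq_comp_equiv q ν, integral_pi_eq_comp_equiv q ν]
  exact hfin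

theorem measureReal_pi_ge_le_exp (ν : ι → Measure K) [∀ i, IsProbabilityMeasure (ν i)]
    {y : (ι → K) → ℝ} (hy : Measurable y) {c : ι → ℝ}
    (h : ∀ i x r, |y x - y (Function.update x i r)| ≤ c i) {m u : ℝ}
    (hm : ∫ x, y x ∂(Measure.pi ν) ≤ m) (hu : 0 ≤ u) :
    (Measure.pi ν).real {x | m + u ≤ y x} ≤ Real.exp (-(2 * u ^ 2) / ∑ i, c i ^ 2) := by
  set S := ∑ i, c i ^ 2 with hS
  have hS₀ : 0 ≤ S := Finset.sum_nonneg fun _ _ => sq_nonneg _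
  rcases hS₀.eq_or_lt with hS₀ | hSpos
  · rw [← hS₀, div_zero, Real.exp_zero]
    exact measureReal_le_one
  set θ := 4 * u / S with hθ
  have hθ₀ : 0 ≤ θ := by positivity
  have hyb := isBddMeasurable_of_abs_sub_update_le hy h
  have hmgf := integral_exp_pi_le ν (y := fun x => θ * y x) (hy.const_mul θ)
    (c := fun i => θ * c i) (fun i x r => by
      rw [← mul_sub, abs_mul, abs_of_nonneg hθ₀]
      exact mul_le_mul_of_nonneg_left (h i x r) hθ₀)
  have hchernoff := measure_ge_le_exp_mul_mgf (μ := Measure.pi ν) (X := y) (m + u) hθ₀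
    ((hyb.const_mul θ).exp.integrable _)
  refine hchernoff.trans ((mul_le_mul_of_nonneg_left hmgf (Real.exp_pos _).le).trans ?_)
  rw [← Real.exp_add, Real.exp_le_exp, integral_const_mul]
  simp only [mul_pow, ← Finset.mul_sum, ← hS]
  have hexponent : -θ * u + θ ^ 2 * S / 8 = -(2 * u ^ 2) / S := by
    rw [hθ]
    field_simp
    ring
  linarith [mul_le_mul_of_nonneg_left hm hθ₀]

variable {Ω : Type*} [MeasurableSpace Ω] {μ : Measure Ω} {X : ι → Ω → K}

theorem measureReal_ge_le_exp_of_iIndepFun (hX : iIndepFun X μ)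
    (hXm : ∀ i, AEMeasurable (X i) μ) {y : (ι → K) → ℝ} (hy : Measurable y) {c : ι → ℝ}
    (h : ∀ i x r, |y x - y (Function.update x i r)| ≤ c i) {m u : ℝ}
    (hm : ∫ ω, y (fun i => X i ω) ∂μ ≤ m) (hu : 0 ≤ u) :
    μ.real {ω | m + u ≤ y fun i => X i ω} ≤ Real.exp (-(2 * u ^ 2) / ∑ i, c i ^ 2) := by
  have := hX.isProbabilityMeasure
  have hν := fun i => Measure.isProbabilityMeasure_map (hXm i)
  have hXpi : AEMeasurable (fun ω i => X i ω) μ := aemeasurable_pi_lambda _ hXm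
  have hlaw := (iIndepFun_iff_map_fun_eq_pi_map hXm).1 hX
  rw [← integral_map hXpi hy.aestronglyMeasurable, hlaw] at hm
  have htail := measureReal_pi_ge_le_exp (fun i => μ.map (X i)) hy h hm hu
  rwa [← hlaw, map_measureReal_apply_of_aemeasurable hXpi (measurableSet_le measurable_const hy)]
    at htail

theorem measureReal_ge_le_exp_of_abs_sub_update_le_mul {X : ι → Ω → ℝ} (hX : iIndepFun X μ)
    (hXm : ∀ i, AEMeasurable (X i) μ) {ε : ℝ} (hε : 0 ≤ ε) (hXε : ∀ i, ∀ᵐ ω ∂μ, |X i ω| ≤ ε)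
    {y : (ι → ℝ) → ℝ} (hy : Measurable y) {L : ι → ℝ} (hL : ∀ i, 0 ≤ L i)
    (h : ∀ i x r, |y x - y (Function.update x i r)| ≤ L i * |x i - r|) {m u : ℝ}
    (hm : ∫ ω, y (fun i => X i ω) ∂μ ≤ m) (hu : 0 ≤ u) :
    μ.real {ω | m + u ≤ y fun i => X i ω} ≤ Real.exp (-u ^ 2 / (2 * ε ^ 2 * ∑ i, L i ^ 2)) := by
  set z : (ι → ℝ) → ℝ := fun x => y fun i => clip ε (x i) with hz
  have hzX : (fun ω => z fun i => X i ω) =ᵐ[μ] fun ω => y fun i => X i ω :=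
    (ae_clip_eq hXε).fun_comp y
  have hset : {ω | m + u ≤ z fun i => X i ω} =ᵐ[μ] {ω | m + u ≤ y fun i => X i ω} :=
    hzX.fun_comp (m + u ≤ ·)
  have hzm : Measurable z := hy.comp
    (measurable_pi_lambda _ fun i => measurable_clip.comp (measurable_pi_apply i))
  have hzdiff : ∀ i x r, |z x - z (Function.update x i r)| ≤ 2 * ε * L i := fun i x r => by
    have hupdate : (fun j => clip ε (Function.update x i r j)) =
        Function.update (fun j => clip ε (x j)) i (clip ε r) :=
      funext fun j => Function.apply_update (fun _ => clip ε) x i r j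
    simp only [hz, hupdate]
    refine (h i _ _).trans ?_
    rw [mul_comm]
    gcongr
    · exact hL i
    · exact (abs_sub _ _).trans (by linarith [abs_clip_le hε (r := x i), abs_clip_le hε (r := r)])
  have htail := measureReal_ge_le_exp_of_iIndepFun hX hXm hzm hzdiff
    ((integral_congr_ae hzX).trans_le hm) hu
  rw [measureReal_congr hset] at htail
  refine htail.trans_eq (congrArg Real.exp ?_)
  simp only [mul_pow, ← Finset.mul_sum]
  rw [show (2 : ℝ) ^ 2 * ε ^ 2 * ∑ i, L i ^ 2 = 2 * (2 * ε ^ 2 * ∑ i, L i ^ 2) by ring, ← mul_neg,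
    mul_div_mul_left _ _ two_ne_zero]

end McDiarmid

section Herbst

open Filter Topology

variable {α : Type*} [MeasurableSpace α] {μ : Measure α} {Z : α → ℝ} {c : ℝ}

theorem hasDerivAt_cgf (hZ : ∀ t, Integrable (fun a => Real.exp (t * Z a)) μ) (t : ℝ) :
    HasDerivAt (cgf Z μ) ((∫ a, Z a * Real.exp (t * Z a) ∂μ) / mgf Z μ t) t := by
  have ht : t ∈ interior (integrableExpSet Z μ) := by
    simp [show integrableExpSet Z μ = Set.univ from Set.eq_univ_of_forall hZ]
  exact deriv_cgf ht ▸ (analyticAt_cgf ht).differentiableAt.hasDerivAt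

variable [IsProbabilityMeasure μ]

theorem antitoneOn_cgf_mul_of_expEntropy_le (hZ : ∀ t, Integrable (fun a => Real.exp (t * Z a)) μ)
    (h : ∀ θ > 0, expEntropy μ (fun a => θ * Z a) ≤
      c * θ ^ 2 * ∫ a, Z a * Real.exp (θ * Z a) ∂μ) :
    AntitoneOn (fun t => cgf Z μ t * (t⁻¹ - c)) (Set.Ioi 0) := by
  have hderiv : ∀ t ∈ Set.Ioi (0 : ℝ), HasDerivAt (fun t => cgf Z μ t * (t⁻¹ - c)) _ t :=
    fun t ht => (hasDerivAt_cgf hZ t).mul ((hasDerivAt_inv (ne_of_gt ht)).sub_const c)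
  refine antitoneOn_of_hasDerivWithinAt_nonpos (convex_Ioi 0)
    (fun t ht => (hderiv t ht).continuousAt.continuousWithinAt)
    (fun t ht => (hderiv t (interior_subset ht)).hasDerivWithinAt) fun t ht => ?_
  have htpos : 0 < t := interior_subset ht
  have hmgf : 0 < mgf Z μ t := mgf_pos (hZ t)
  have hent := h t htpos
  simp only [expEntropy, mul_assoc, integral_const_mul] at hent
  set E := ∫ a, Z a * Real.exp (t * Z a) ∂μ
  change t * E - mgf Z μ t * cgf Z μ t ≤ c * (t ^ 2 * E) at hent
  have hnumerator : E / mgf Z μ t * (t⁻¹ - c) + cgf Z μ t * -(t ^ 2)⁻¹ =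
      (t * E - mgf Z μ t * cgf Z μ t - c * (t ^ 2 * E)) / (mgf Z μ t * t ^ 2) := by
    field_simp
    ring
  rw [hnumerator]
  exact div_nonpos_of_nonpos_of_nonneg (by linarith) (by positivity)

theorem tendsto_cgf_mul (hZ : ∀ t, Integrable (fun a => Real.exp (t * Z a)) μ) :
    Tendsto (fun t => cgf Z μ t * (t⁻¹ - c)) (𝓝[>] 0) (𝓝 (∫ a, Z a ∂μ)) := by
  have hderiv := hasDerivAt_cgf hZ 0
  have hslope := hderiv.tendsto_slope_zero_right
  have hcgf : Tendsto (cgf Z μ) (𝓝[>] 0) (𝓝 0) := by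
    simpa only [cgf_zero] using hderiv.continuousAt.tendsto.mono_left nhdsWithin_le_nhds
  have hsub := hslope.sub (hcgf.mul_const c)
  simp only [mgf_zero, zero_mul, Real.exp_zero, mul_one, div_one, sub_zero, zero_add, cgf_zero,
    smul_eq_mul] at hsub
  exact hsub.congr fun t => by ring

theorem cgf_mul_le_of_expEntropy_le (hZ : ∀ t, Integrable (fun a => Real.exp (t * Z a)) μ)
    (h : ∀ θ > 0, expEntropy μ (fun a => θ * Z a) ≤
      c * θ ^ 2 * ∫ a, Z a * Real.exp (θ * Z a) ∂μ) {θ : ℝ} (hθ : 0 < θ) :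
    cgf Z μ θ * (θ⁻¹ - c) ≤ ∫ a, Z a ∂μ := by
  refine ge_of_tendsto (tendsto_cgf_mul (c := c) hZ) ?_
  filter_upwards [Ioo_mem_nhdsGT hθ] with t ht
  exact antitoneOn_cgf_mul_of_expEntropy_le hZ h ht.1 hθ ht.2.le

theorem measureReal_ge_le_exp_of_expEntropy_le
    (hZ : ∀ t, Integrable (fun a => Real.exp (t * Z a)) μ) (hc : 0 < c)
    (h : ∀ θ > 0, expEntropy μ (fun a => θ * Z a) ≤
      c * θ ^ 2 * ∫ a, Z a * Real.exp (θ * Z a) ∂μ) {m u : ℝ}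
    (hm : ∫ a, Z a ∂μ ≤ m) (hm₀ : 0 < m) (hu : 0 < u) :
    μ.real {a | m + u ≤ Z a} ≤ Real.exp (-u ^ 2 / (2 * c * (2 * m + u))) := by
  set θ := u / (c * (2 * m + u)) with hθ
  have hθ₀ : 0 < θ := by positivity
  have hfactor : θ⁻¹ - c = 2 * c * m / u := by
    rw [hθ]
    field_simp
    ring
  have hcgf : cgf Z μ θ ≤ u / (2 * c) := by
    have hmul := (cgf_mul_le_of_expEntropy_le hZ h hθ₀).trans hm
    rw [hfactor] at hmul
    refine le_of_mul_le_mul_right (hmul.trans_eq ?_) (by positivity : 0 < 2 * c * m / u)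
    field_simp
  refine (measure_ge_le_exp_cgf (m + u) hθ₀.le (hZ θ)).trans (Real.exp_le_exp.2 ?_)
  have hexponent : -θ * (m + u) + u / (2 * c) = -u ^ 2 / (2 * c * (2 * m + u)) := by
    rw [hθ]
    field_simp
    ring
  linarith

end Herbst

section Quadratic

open Matrix

theorem half_sum_sq_mulVec_sub_le {m n : Type*} [Fintype m] [Fintype n] (A : Matrix m n ℝ)
    {u v : n → ℝ} {i : n} (h : ∀ j, j ≠ i → u j = v j) :
    (1 / 2) * ∑ k, (A *ᵥ u) k ^ 2 - (1 / 2) * ∑ k, (A *ᵥ v) k ^ 2 ≤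
      (Aᵀ *ᵥ (A *ᵥ u)) i * (u i - v i) := by
  have hcoordinate : ∀ k, (A *ᵥ u) k - (A *ᵥ v) k = A k i * (u i - v i) := fun k => by
    rw [← Pi.sub_apply, ← mulVec_sub, mulVec, dotProduct,
      Finset.sum_eq_single i (fun j _ hj => by rw [Pi.sub_apply, h j hj, sub_self, mul_zero])
        (fun hi => absurd (Finset.mem_univ i) hi), Pi.sub_apply]
  rw [← mul_sub, ← Finset.sum_sub_distrib, Finset.mul_sum, mulVec, dotProduct, Finset.sum_mul]
  refine Finset.sum_le_sum fun k _ => ?_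
  rw [transpose_apply, mul_right_comm, ← hcoordinate k]
  linarith [sq_nonneg ((A *ᵥ u) k - (A *ᵥ v) k)]

variable {ι m K : Type*} [MeasurableSpace K]

theorem isBddMeasurable_mulVec [Fintype ι] (A : Matrix m ι ℝ) {f : ι → K → ℝ}
    (hf : ∀ i, IsBddMeasurable (f i)) (k : m) :
    IsBddMeasurable fun x => (A *ᵥ fun i => f i x) k :=
  .sum fun i _ => (hf i).const_mul (A k i)

theorem isBddMeasurable_half_sum_sq_mulVec [Fintype ι] [Fintype m] (A : Matrix m ι ℝ)
    {f : ι → K → ℝ} (hf : ∀ i, IsBddMeasurable (f i)) :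
    IsBddMeasurable fun x => (1 / 2) * ∑ k, (A *ᵥ fun i => f i x) k ^ 2 := by
  simp only [pow_two]
  exact (IsBddMeasurable.sum fun k _ =>
    (isBddMeasurable_mulVec A hf k).mul (isBddMeasurable_mulVec A hf k)).const_mul _

variable [Fintype ι] (ν : ι → Measure K) [∀ i, IsProbabilityMeasure (ν i)] {c : K → ℝ} {ε : ℝ}

theorem expEntropy_pi_le_of_slope [DecidableEq ι] {y : (ι → K) → ℝ} {d : ι → (ι → K) → ℝ}
    (hy : IsBddMeasurable y) (hd : ∀ i, IsBddMeasurable (d i)) (hc : Measurable c)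
    (hε : ∀ a, |c a| ≤ ε) (hc₀ : ∀ i, ∫ a, c a ∂(ν i) = 0)
    (hslope : ∀ i x r, y x - y (Function.update x i r) ≤ d i x * (c (x i) - c r)) :
    expEntropy (Measure.pi ν) y ≤
      ∫ x, 2 * ε ^ 2 * ((∑ i, d i x ^ 2) * Real.exp (y x)) ∂(Measure.pi ν) := by
  have hB : ∀ i, IsBddMeasurable fun x => 2 * ε ^ 2 * (d i x ^ 2 * Real.exp (y x)) := fun i => by
    simpa only [pow_two (d i _)] using (((hd i).mul (hd i)).mul hy.exp).const_mul (2 * ε ^ 2)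
  have hcoordinate : ∀ i, ∀ x : ι → K, expEntropy (ν i) (fun r => y (Function.update x i r)) ≤
      ∫ r, 2 * ε ^ 2 * (d i (Function.update x i r) ^ 2 *
        Real.exp (y (Function.update x i r))) ∂(ν i) := fun i x => by
    have hup : Measurable fun r : K => Function.update x i r := by fun_prop
    refine expEntropy_le_integral_sq_mul_exp (ν i) hc (hy.comp hup) ((hd i).comp hup) hε (hc₀ i)
      fun a b => ?_
    simpa only [Function.update_idem, Function.update_self] using
      hslope i (Function.update x i a) b
  simp only [Finset.sum_mul, Finset.mul_sum]
  rw [integral_finsetSum _ fun i _ => (hB i).integrable _]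
  refine (expEntropy_pi_le ν hy).trans (Finset.sum_le_sum fun i _ => ?_)
  rw [← integral_integral_update ν i (hB i)]
  exact integral_mono ((hy.expEntropy_update i (ν i)).integrable _)
    ((((hB i).comp (measurePreserving_update ν i).measurable).integral_right (ν i)).integrable _)
    (hcoordinate i)

variable [Fintype m] {A : Matrix m ι ℝ} {l : ℝ}

theorem expEntropy_pi_half_sum_sq_mulVec_le (hA : ∀ v, ∑ j, (Aᵀ *ᵥ v) j ^ 2 ≤ l * ∑ k, v k ^ 2)
    (hc : Measurable c) (hε : ∀ a, |c a| ≤ ε) (hc₀ : ∀ i, ∫ a, c a ∂(ν i) = 0) {θ : ℝ}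
    (hθ : 0 ≤ θ) {Z : (ι → K) → ℝ}
    (hZ : Z = fun x => (1 / 2) * ∑ k, (A *ᵥ fun i => c (x i)) k ^ 2) :
    expEntropy (Measure.pi ν) (fun x => θ * Z x) ≤
      4 * ε ^ 2 * l * θ ^ 2 * ∫ x, Z x * Real.exp (θ * Z x) ∂(Measure.pi ν) := by
  classical
  have hcb : ∀ i, IsBddMeasurable fun x : ι → K => c (x i) := fun i =>
    IsBddMeasurable.comp ⟨hc, ε, hε⟩ (measurable_pi_apply i)
  have hZb : IsBddMeasurable Z := hZ ▸ isBddMeasurable_half_sum_sq_mulVec A hcb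
  have hθZ := hZb.const_mul θ
  set d : ι → (ι → K) → ℝ := fun i x => θ * (Aᵀ *ᵥ (A *ᵥ fun j => c (x j))) i
  have hd : ∀ i, IsBddMeasurable (d i) := fun i =>
    (isBddMeasurable_mulVec Aᵀ (isBddMeasurable_mulVec A hcb) i).const_mul θ
  have hslope : ∀ i x r, θ * Z x - θ * Z (Function.update x i r) ≤ d i x * (c (x i) - c r) :=
    fun i x r => by
      have h := half_sum_sq_mulVec_sub_le A (u := fun j => c (x j))
        (v := fun j => c (Function.update x i r j)) (i := i) fun j hj => by
          simp only [Function.update_of_ne hj]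
      rw [Function.update_self] at h
      rw [← mul_sub, mul_assoc, hZ]
      exact mul_le_mul_of_nonneg_left h hθ
  have hgradient : ∀ x, ∑ i, d i x ^ 2 ≤ θ ^ 2 * (l * (2 * Z x)) := fun x => by
    have hAx := hA (A *ᵥ fun i => c (x i))
    simp only [d, mul_pow, ← Finset.mul_sum]
    gcongr
    rw [hZ]
    linarith
  have hsum : IsBddMeasurable fun x => ∑ i, d i x ^ 2 := by
    simpa only [pow_two] using IsBddMeasurable.sum fun i _ => (hd i).mul (hd i)
  refine (expEntropy_pi_le_of_slope ν hθZ hd hc hε hc₀ hslope).trans ?_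
  rw [← integral_const_mul]
  refine integral_mono (((hsum.mul hθZ.exp).const_mul _).integrable _)
    (((hZb.mul hθZ.exp).const_mul _).integrable _) fun x => ?_
  calc 2 * ε ^ 2 * ((∑ i, d i x ^ 2) * Real.exp (θ * Z x))
      ≤ 2 * ε ^ 2 * (θ ^ 2 * (l * (2 * Z x)) * Real.exp (θ * Z x)) := by
        gcongr
        exact hgradient x
    _ = 4 * ε ^ 2 * l * θ ^ 2 * (Z x * Real.exp (θ * Z x)) := by ring

variable {Ω : Type*} [MeasurableSpace Ω] {μ : Measure Ω} {X : ι → Ω → ℝ}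

theorem measureReal_half_sum_sq_mulVec_ge_le_exp (hX : iIndepFun X μ)
    (hXm : ∀ i, AEMeasurable (X i) μ) (hX₀ : ∀ i, ∫ ω, X i ω ∂μ = 0) (hε : 0 < ε)
    (hXε : ∀ i, ∀ᵐ ω ∂μ, |X i ω| ≤ ε) (hl : 0 < l)
    (hA : ∀ v, ∑ j, (Aᵀ *ᵥ v) j ^ 2 ≤ l * ∑ k, v k ^ 2) {M u : ℝ}
    (hM : ∫ ω, (1 / 2) * ∑ k, (A *ᵥ fun i => X i ω) k ^ 2 ∂μ ≤ M) (hM₀ : 0 < M) (hu : 0 < u) :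
    μ.real {ω | M + u ≤ (1 / 2) * ∑ k, (A *ᵥ fun i => X i ω) k ^ 2} ≤
      Real.exp (-u ^ 2 / (8 * ε ^ 2 * l * (2 * M + u))) := by
  have := hX.isProbabilityMeasure
  have hν := fun i => Measure.isProbabilityMeasure_map (hXm i)
  have hXpi : AEMeasurable (fun ω i => X i ω) μ := aemeasurable_pi_lambda _ hXm
  have hlaw := (iIndepFun_iff_map_fun_eq_pi_map hXm).1 hX
  have habs := fun r => abs_clip_le (r := r) hε.le
  set Z : (ι → ℝ) → ℝ := fun x => (1 / 2) * ∑ k, (A *ᵥ fun i => clip ε (x i)) k ^ 2 with hZ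
  have hZb : IsBddMeasurable Z := isBddMeasurable_half_sum_sq_mulVec A fun i =>
    IsBddMeasurable.comp ⟨measurable_clip, ε, habs⟩ (measurable_pi_apply i)
  have hZX : (fun ω => Z fun i => X i ω) =ᵐ[μ]
      fun ω => (1 / 2) * ∑ k, (A *ᵥ fun i => X i ω) k ^ 2 :=
    (ae_clip_eq hXε).fun_comp fun x => (1 / 2) * ∑ k, (A *ᵥ x) k ^ 2
  have hcentred : ∀ i, ∫ r, clip ε r ∂(μ.map (X i)) = 0 := fun i => by
    rw [integral_map (hXm i) measurable_clip.aestronglyMeasurable, ← hX₀ i]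
    exact integral_congr_ae ((hXε i).mono fun ω hω => clip_of_abs_le hω)
  have htail := measureReal_ge_le_exp_of_expEntropy_le (μ := Measure.pi fun i => μ.map (X i))
    (c := 4 * ε ^ 2 * l) (Z := Z) (m := M) (fun t => (hZb.const_mul t).exp.integrable _)
    (by positivity)
    (fun θ hθ => expEntropy_pi_half_sum_sq_mulVec_le _ hA measurable_clip habs hcentred hθ.le hZ)
    (by rwa [← hlaw, integral_map hXpi hZb.measurable.aestronglyMeasurable, integral_congr_ae hZX])
    hM₀ hu
  have hset : {ω | M + u ≤ Z fun i => X i ω} =ᵐ[μ]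
      {ω | M + u ≤ (1 / 2) * ∑ k, (A *ᵥ fun i => X i ω) k ^ 2} := hZX.fun_comp (M + u ≤ ·)
  rw [← hlaw, map_measureReal_apply_of_aemeasurable hXpi
    (measurableSet_le measurable_const hZb.measurable)] at htail
  rw [← measureReal_congr hset]
  refine htail.trans_eq (congrArg Real.exp ?_)
  ring

end Quadratic

section WindowCost

variable {β : ℝ} {z z' x x' : ℤ → ℝ} {a b : ℤ}

theorem windowCost_lineMap_le (hβ : 0 ≤ β) (z x v : ℤ → ℝ) (a b : ℤ) {θ : ℝ}
    (hθ₀ : 0 ≤ θ) (hθ₁ : θ ≤ 1) :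
    windowCost β z a b (fun t => (1 - θ) * x t + θ * v t) ≤
      (1 - θ) * windowCost β z a b x + θ * windowCost β z a b v
        - θ * (1 - θ) * ((1 / 2) * ∑ t ∈ Finset.Icc a b, (x t - v t) ^ 2) := by
  simp only [windowCost, Finset.mul_sum]
  rw [← Finset.sum_add_distrib, ← Finset.sum_sub_distrib]
  refine Finset.sum_le_sum fun t _ => ?_
  have hmove : |(1 - θ) * x t + θ * v t - ((1 - θ) * x (t - 1) + θ * v (t - 1))| ≤
      (1 - θ) * |x t - x (t - 1)| + θ * |v t - v (t - 1)| :=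
    calc _ = |(1 - θ) * (x t - x (t - 1)) + θ * (v t - v (t - 1))| := by ring_nf
      _ ≤ |(1 - θ) * (x t - x (t - 1))| + |θ * (v t - v (t - 1))| := abs_add_le _ _
      _ = _ := by rw [abs_mul, abs_mul, abs_of_nonneg hθ₀, abs_of_nonneg (sub_nonneg.2 hθ₁)]
  linear_combination β * hmove

theorem SolvesWindow.windowCost_add_sum_sq_le (hβ : 0 ≤ β) (hx : SolvesWindow β z a b x)
    {v : ℤ → ℝ} (hv : v (a - 1) = x (a - 1)) :
    windowCost β z a b x + (1 / 2) * ∑ t ∈ Finset.Icc a b, (x t - v t) ^ 2 ≤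
      windowCost β z a b v := by
  set S := (1 / 2) * ∑ t ∈ Finset.Icc a b, (x t - v t) ^ 2
  have hsegment : ∀ θ ∈ Set.Ioo (0 : ℝ) 1,
      windowCost β z a b x + (1 - θ) * S ≤ windowCost β z a b v := fun θ ⟨hθ₀, hθ₁⟩ => by
    have hmin := hx (fun t => (1 - θ) * x t + θ * v t) (by simp only [hv]; ring)
    have hconvex := windowCost_lineMap_le hβ z x v a b hθ₀.le hθ₁.le
    exact le_of_mul_le_mul_left (by linear_combination hmin + hconvex) hθ₀
  have hlim : Filter.Tendsto (fun θ : ℝ => windowCost β z a b x + (1 - θ) * S)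
      (nhdsWithin 0 (Set.Ioi 0)) (nhds (windowCost β z a b x + S)) := by
    have : Continuous fun θ : ℝ => windowCost β z a b x + (1 - θ) * S := by fun_prop
    simpa using (this.tendsto 0).mono_left nhdsWithin_le_nhds
  exact le_of_tendsto hlim
    (Filter.eventually_of_mem (Ioo_mem_nhdsGT one_pos) hsegment)

theorem windowCost_update_le (hβ : 0 ≤ β) (z x : ℤ → ℝ) (a b t : ℤ) (p : ℝ) :
    windowCost β z a b (Function.update x t p) ≤ windowCost β z a b x
      + (if t ∈ Finset.Icc a b then
          (1 / 2) * ((z t - p) ^ 2 - (z t - x t) ^ 2) + β * |x t - p| else 0)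
      + if t + 1 ∈ Finset.Icc a b then β * |x t - p| else 0 := by
  rw [← Finset.sum_ite_eq' (Finset.Icc a b) t fun i =>
      (1 / 2) * ((z i - p) ^ 2 - (z i - x i) ^ 2) + β * |x i - p|,
    ← Finset.sum_ite_eq' (Finset.Icc a b) (t + 1) fun _ => β * |x t - p|]
  simp only [windowCost]
  rw [← Finset.sum_add_distrib, ← Finset.sum_add_distrib]
  refine Finset.sum_le_sum fun i _ => ?_
  rcases eq_or_ne i t with rfl | hi
  · have htriangle := abs_sub_le p (x i) (x (i - 1))
    rw [abs_sub_comm p (x i)] at htriangle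
    simp only [Function.update_self, Function.update_of_ne (show i - 1 ≠ i by omega), if_true,
      if_neg (show i ≠ i + 1 by omega)]
    linear_combination β * htriangle
  rcases eq_or_ne i (t + 1) with rfl | hi'
  · have htriangle := abs_sub_le (x (t + 1)) (x t) p
    simp only [Function.update_of_ne hi, add_sub_cancel_right, Function.update_self, if_neg hi,
      if_true]
    linear_combination β * htriangle
  · simp only [Function.update_of_ne hi, Function.update_of_ne (show i - 1 ≠ t by omega), if_neg hi,
      if_neg hi', add_zero, le_refl]

theorem SolvesWindow.abs_sub_le (hβ : 0 ≤ β) (hx : SolvesWindow β z a b x) {t : ℤ}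
    (ht : t ∈ Finset.Icc a b) :
    |x t - z t| ≤ β + if t + 1 ∈ Finset.Icc a b then β else 0 := by
  have htab := Finset.mem_Icc.1 ht
  have hgrowth := hx.windowCost_add_sum_sq_le hβ (v := Function.update x t (z t))
    (Function.update_of_ne (by omega) _ _)
  have hupdate := windowCost_update_le hβ z x a b t (z t)
  have hsingle : (x t - z t) ^ 2 ≤
      ∑ i ∈ Finset.Icc a b, (x i - Function.update x t (z t) i) ^ 2 := by
    simpa only [Function.update_self] using Finset.single_le_sum
      (f := fun i => (x i - Function.update x t (z t) i) ^ 2) (fun i _ => sq_nonneg _) ht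
  rw [if_pos ht] at hupdate
  have hsq : |x t - z t| * |x t - z t| ≤
      |x t - z t| * (β + if t + 1 ∈ Finset.Icc a b then β else 0) := by
    rw [abs_mul_abs_self]
    split_ifs at hupdate ⊢ <;> linarith
  rcases (abs_nonneg (x t - z t)).eq_or_lt with hzero | hpos
  · rw [← hzero]
    positivity
  · exact le_of_mul_le_mul_left hsq hpos

theorem SolvesWindow.windowCost_add_sum_sq_le_add (hβ : 0 ≤ β) (hx : SolvesWindow β z a b x)
    (v : ℤ → ℝ) :
    windowCost β z a b x + (1 / 2) * ∑ t ∈ Finset.Icc a b, (x t - v t) ^ 2 ≤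
      windowCost β z a b v + β * |x (a - 1) - v (a - 1)| := by
  set v' := Function.update v (a - 1) (x (a - 1)) with hv'
  have hsum : ∑ t ∈ Finset.Icc a b, (x t - v' t) ^ 2 = ∑ t ∈ Finset.Icc a b, (x t - v t) ^ 2 :=
    Finset.sum_congr rfl fun t ht => by
      rw [hv', Function.update_of_ne (by rw [Finset.mem_Icc] at ht; omega)]
  have hgrowth := hx.windowCost_add_sum_sq_le hβ (v := v') (Function.update_self _ _ _)
  have hupdate := windowCost_update_le hβ z v a b (a - 1) (x (a - 1))
  rw [if_neg (by simp), add_zero, abs_sub_comm] at hupdate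
  have hmove : 0 ≤ β * |x (a - 1) - v (a - 1)| := by positivity
  rw [hsum] at hgrowth
  split_ifs at hupdate <;> linarith

theorem windowCost_sub_windowCost (β : ℝ) (y z x v : ℤ → ℝ) (a b : ℤ) :
    windowCost β y a b x - windowCost β y a b v =
      windowCost β z a b x - windowCost β z a b v
        + ∑ t ∈ Finset.Icc a b, (y t - z t) * (v t - x t) := by
  simp only [windowCost]
  rw [← Finset.sum_sub_distrib, ← Finset.sum_sub_distrib, ← Finset.sum_add_distrib]
  exact Finset.sum_congr rfl fun t _ => by ring

theorem SolvesWindow.windowCost_le_of_targets (hβ : 0 ≤ β) (hx : SolvesWindow β z a b x)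
    (y v : ℤ → ℝ) :
    windowCost β y a b x ≤ windowCost β y a b v + β * |x (a - 1) - v (a - 1)|
      + ∑ t ∈ Finset.Icc a b, (1 / 2) * (y t - z t) ^ 2 := by
  have hcross : ∑ t ∈ Finset.Icc a b, (y t - z t) * (v t - x t) ≤
      ∑ t ∈ Finset.Icc a b, (1 / 2) * (y t - z t) ^ 2
        + (1 / 2) * ∑ t ∈ Finset.Icc a b, (x t - v t) ^ 2 := by
    rw [Finset.mul_sum, ← Finset.sum_add_distrib]
    refine Finset.sum_le_sum fun t _ => ?_
    linear_combination (1 / 2) * sq_nonneg ((y t - z t) - (v t - x t))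
  linarith [windowCost_sub_windowCost β y z x v a b, hx.windowCost_add_sum_sq_le_add hβ v]

theorem SolvesWindow.sum_sq_sub_le (hβ : 0 ≤ β) (hx : SolvesWindow β z a b x)
    (hx' : SolvesWindow β z' a b x') :
    ∑ t ∈ Finset.Icc a b, (x t - x' t) ^ 2 ≤
      ∑ t ∈ Finset.Icc a b, (z t - z' t) ^ 2 + 4 * β * |x (a - 1) - x' (a - 1)| := by
  have hgrowth := hx.windowCost_add_sum_sq_le_add hβ x'
  have hgrowth' := hx'.windowCost_add_sum_sq_le_add hβ x
  rw [abs_sub_comm, Finset.sum_congr rfl fun t _ => sub_sq_comm (x' t) (x t)] at hgrowth'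
  have hcross : ∑ t ∈ Finset.Icc a b, -((z t - z' t) * (x' t - x t)) ≤
      ∑ t ∈ Finset.Icc a b,
        ((1 / 2) * (z t - z' t) ^ 2 + (1 / 2) * (x t - x' t) ^ 2) := by
    refine Finset.sum_le_sum fun t _ => ?_
    linear_combination (1 / 2) * sq_nonneg ((z t - z' t) + (x' t - x t))
  rw [Finset.sum_neg_distrib, Finset.sum_add_distrib, ← Finset.mul_sum, ← Finset.mul_sum] at hcross
  linarith [windowCost_sub_windowCost β z z' x x' a b]

theorem convexOn_windowCost (hβ : 0 ≤ β) (z : ℤ → ℝ) (a b : ℤ) :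
    ConvexOn ℝ Set.univ (windowCost β z a b) := by
  refine ⟨convex_univ, fun x _ v _ r s _ hs hrs => ?_⟩
  obtain rfl : r = 1 - s := by linarith
  have hgap : 0 ≤ s * (1 - s) * ((1 / 2) * ∑ t ∈ Finset.Icc a b, (x t - v t) ^ 2) := by
    positivity
  exact (windowCost_lineMap_le hβ z x v a b hs (by linarith)).trans (sub_le_self _ hgap)

end WindowCost

section Spectrum

open Matrix

variable {m n : Type*} [Fintype m] [Fintype n]

theorem dotProduct_mul_transpose_mulVec (A : Matrix m n ℝ) (v : m → ℝ) :
    v ⬝ᵥ (A * Aᵀ) *ᵥ v = ∑ j, (Aᵀ *ᵥ v) j ^ 2 := by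
  rw [← mulVec_mulVec, dotProduct_mulVec, ← mulVec_transpose]
  simp only [dotProduct, sq]

variable [DecidableEq m]

open scoped MatrixOrder in
theorem sum_transpose_mulVec_sq_le (A : Matrix m n ℝ) (v : m → ℝ) :
    ∑ j, (Aᵀ *ᵥ v) j ^ 2 ≤ sSup (spectrum ℝ (A * Aᵀ)) * ∑ i, v i ^ 2 := by
  have hA : (A * Aᵀ).IsHermitian := isHermitian_mul_conjTranspose_self A
  have hbdd : BddAbove (spectrum ℝ (A * Aᵀ)) := by
    rw [hA.spectrum_real_eq_range_eigenvalues]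
    exact (Set.finite_range _).bddAbove
  have hle : A * Aᵀ ≤ algebraMap ℝ (Matrix m m ℝ) (sSup (spectrum ℝ (A * Aᵀ))) :=
    le_algebraMap_of_spectrum_le (ha := hA) fun x hx => le_csSup hbdd hx
  have hform := (Matrix.le_iff.1 hle).dotProduct_mulVec_nonneg v
  rw [star_trivial, sub_mulVec, dotProduct_sub, dotProduct_mul_transpose_mulVec,
    Algebra.algebraMap_eq_smul_one, smul_mulVec, one_mulVec, dotProduct_smul, sub_nonneg] at hform
  simpa only [dotProduct, sq, smul_eq_mul] using hform

theorem le_of_mem_spectrum_mul_transpose {A : Matrix m n ℝ} {c : ℝ} (hc : 0 ≤ c)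
    (hA : ∀ u, ∑ i, (A *ᵥ u) i ^ 2 ≤ c * ∑ j, u j ^ 2) {x : ℝ}
    (hx : x ∈ spectrum ℝ (A * Aᵀ)) : x ≤ c := by
  rw [← spectrum_toLin', ← Module.End.hasEigenvalue_iff_mem_spectrum] at hx
  obtain ⟨v, hv⟩ := hx.exists_hasEigenvector
  have heigen : (A * Aᵀ) *ᵥ v = x • v := by
    rw [← toLin'_apply]
    exact hv.apply_eq_smul
  have hform : ∑ j, (Aᵀ *ᵥ v) j ^ 2 = x * ∑ i, v i ^ 2 := by
    rw [← dotProduct_mul_transpose_mulVec, heigen, dotProduct_smul]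
    simp only [dotProduct, sq, smul_eq_mul]
  have hnorm : x ^ 2 * ∑ i, v i ^ 2 ≤ c * (x * ∑ i, v i ^ 2) := by
    simpa only [mulVec_mulVec, heigen, hform, Pi.smul_apply, smul_eq_mul, mul_pow,
      ← Finset.mul_sum] using hA (Aᵀ *ᵥ v)
  have hpos : 0 < ∑ i, v i ^ 2 := by
    obtain ⟨i, hi⟩ := Function.ne_iff.1 hv.2
    exact Finset.sum_pos' (fun _ _ => sq_nonneg _) ⟨i, Finset.mem_univ i, sq_pos_iff.2 hi⟩
  by_contra! hcx
  nlinarith [mul_pos (mul_pos (hc.trans_lt hcx) (sub_pos.2 hcx)) hpos]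

theorem sSup_spectrum_mul_transpose_pos {A : Matrix m n ℝ} {i : m} {j : n} (hij : A i j ≠ 0) :
    0 < sSup (spectrum ℝ (A * Aᵀ)) := by
  have hrow := sum_transpose_mulVec_sq_le A (Pi.single i 1)
  have hunit : ∑ k, (Pi.single i 1 : m → ℝ) k ^ 2 = 1 := by
    simp [Pi.single_apply]
  simp only [mulVec_single_one, col_apply, transpose_apply, hunit, mul_one] at hrow
  exact (Finset.sum_pos' (fun _ _ => sq_nonneg _)
    ⟨j, Finset.mem_univ j, by positivity⟩).trans_le hrow

end Spectrum

section Windows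

variable {w T k : ℕ} {τ τ' t : ℤ}

theorem mem_startTimes :
    τ ∈ startTimes w T k ↔ (-(w : ℤ) ≤ τ ∧ τ ≤ T) ∧ τ ≡ (k : ℤ) [ZMOD ((w : ℤ) + 1)] := by
  simp only [startTimes, Finset.mem_filter, Finset.mem_Icc]

theorem mem_windowSlots : t ∈ windowSlots w T τ ↔ (1 ≤ t ∧ t ≤ T) ∧ τ ≤ t ∧ t ≤ τ + w := by
  simp only [windowSlots, Finset.mem_Icc]
  omega

theorem exists_startTime (w T k : ℕ) (ht₁ : 1 ≤ t) (htT : t ≤ T) :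
    ∃ τ ∈ startTimes w T k, τ ≤ t ∧ t ≤ τ + w := by
  have hperiod : (0 : ℤ) < (w : ℤ) + 1 := by positivity
  have hnonneg := Int.emod_nonneg (t - k) hperiod.ne'
  have hlt := Int.emod_lt_of_pos (t - k) hperiod
  refine ⟨t - (t - k) % ((w : ℤ) + 1), mem_startTimes.2 ⟨⟨by omega, by omega⟩, ?_⟩,
    by omega, by omega⟩
  rw [Int.modEq_comm, Int.modEq_iff_dvd]
  exact ⟨(t - k) / ((w : ℤ) + 1), by linarith [Int.emod_add_mul_ediv (t - k) ((w : ℤ) + 1)]⟩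

theorem startTime_unique (hτ : τ ∈ startTimes w T k) (hτ' : τ' ∈ startTimes w T k)
    (ht : τ ≤ t ∧ t ≤ τ + w) (ht' : τ' ≤ t ∧ t ≤ τ' + w) : τ = τ' := by
  have hmod := (mem_startTimes.1 hτ).2.trans (mem_startTimes.1 hτ').2.symm
  rcases lt_trichotomy τ τ' with hlt | heq | hlt
  · have := Int.le_of_dvd (by omega) hmod.dvd
    omega
  · exact heq
  · have := Int.le_of_dvd (by omega) hmod.symm.dvd
    omega

theorem sum_startTimes_sum_windowSlots (w T k : ℕ) (h : ℤ → ℝ) :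
    ∑ τ ∈ startTimes w T k, ∑ t ∈ windowSlots w T τ, h t = ∑ t ∈ Finset.Icc (1 : ℤ) T, h t := by
  rw [← Finset.sum_biUnion]
  · refine Finset.sum_congr ?_ fun _ _ => rfl
    ext t
    simp only [Finset.mem_biUnion, mem_windowSlots, Finset.mem_Icc]
    refine ⟨fun ⟨_, _, ht, _⟩ => ht, fun ht => ?_⟩
    obtain ⟨τ, hτ, htτ⟩ := exists_startTime w T k ht.1 ht.2
    exact ⟨τ, hτ, ht, htτ⟩
  · intro τ hτ τ' hτ' hne
    rw [Function.onFun, Finset.disjoint_left]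
    exact fun t ht ht' =>
      hne (startTime_unique hτ hτ' (mem_windowSlots.1 ht).2 (mem_windowSlots.1 ht').2)

theorem sum_range_sum_startTimes (w T : ℕ) (h : ℤ → ℝ) :
    ∑ k ∈ Finset.range (w + 1), ∑ τ ∈ startTimes w T k, h τ =
      ∑ τ ∈ Finset.Icc (-(w : ℤ)) T, h τ := by
  have hperiod : (0 : ℤ) < (w : ℤ) + 1 := by positivity
  rw [← Finset.sum_fiberwise_of_maps_to (s := Finset.Icc (-(w : ℤ)) T)
    (t := Finset.range (w + 1)) (g := fun τ => (τ % ((w : ℤ) + 1)).toNat)]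
  · refine Finset.sum_congr rfl fun k hk => Finset.sum_congr ?_ fun _ _ => rfl
    rw [Finset.mem_range] at hk
    refine Finset.filter_congr fun τ _ => ?_
    have := Int.emod_nonneg τ hperiod.ne'
    rw [Int.ModEq, Int.emod_eq_of_lt (a := (k : ℤ)) (by omega) (by omega)]
    omega
  · intro τ _
    have := Int.emod_nonneg τ hperiod.ne'
    have := Int.emod_lt_of_pos τ hperiod
    rw [Finset.mem_range]
    omega

theorem sum_Icc_comp_sub_left_le {g : ℤ → ℝ} (hg : ∀ j, 0 ≤ g j) {a t : ℤ} {n : ℕ}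
    (hn : t - a < n) : ∑ s ∈ Finset.Icc a t, g (t - s) ≤ ∑ j ∈ Finset.range n, g j := by
  rw [← Finset.sum_image (s := Finset.range n) (g := Nat.cast) (f := g) Nat.cast_injective.injOn,
    ← Finset.sum_image (s := Finset.Icc a t) (g := fun s => t - s) (f := g)
      fun s _ s' _ h => sub_right_injective h]
  refine Finset.sum_le_sum_of_subset_of_nonneg (fun j hj => ?_) fun j _ _ => hg j
  simp only [Finset.mem_image, Finset.mem_Icc, Finset.mem_range] at hj ⊢
  exact ⟨j.toNat, by omega, by omega⟩

theorem sum_Icc_comp_sub_right_le {g : ℤ → ℝ} (hg : ∀ j, 0 ≤ g j) {a b : ℤ} {n : ℕ}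
    (hn : b - a < n) : ∑ t ∈ Finset.Icc a b, g (t - a) ≤ ∑ j ∈ Finset.range n, g j := by
  refine le_of_eq_of_le (Finset.sum_bij' (fun t _ => a + b - t) (fun t _ => a + b - t)
    ?_ ?_ ?_ ?_ ?_) (sum_Icc_comp_sub_left_le hg hn)
  all_goals simp only [Finset.mem_Icc]
  · omega
  · omega
  · omega
  · omega
  · exact fun t _ => congrArg g (by ring)

theorem sum_range_sum_range_succ (g : ℕ → ℝ) (w : ℕ) :
    ∑ i ∈ Finset.range (w + 1), ∑ j ∈ Finset.range (i + 1), g j =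
      ∑ j ∈ Finset.range (w + 1), ((w : ℝ) - j + 1) * g j := by
  induction w with
  | zero => simp
  | succ w ih =>
    rw [Finset.sum_range_succ, ih, Finset.sum_range_succ _ (w + 1),
      Finset.sum_range_succ (fun j => (((w + 1 : ℕ) : ℝ) - j + 1) * g j), ← add_assoc,
      ← Finset.sum_add_distrib]
    congr 1
    · refine Finset.sum_congr rfl fun j _ => ?_
      push_cast
      ring
    · simp

theorem fNormSq_eq_sq_mul (σ : ℝ) (f : ℤ → ℝ) (w : ℕ) : fNormSq σ f w = σ ^ 2 * fNormSq 1 f w := by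
  simp only [fNormSq, one_pow, one_mul]

theorem bigF_eq_sq_mul (σ : ℝ) (f : ℤ → ℝ) (w : ℕ) : bigF σ f w = σ ^ 2 * bigF 1 f w := by
  simp only [bigF, one_pow, one_mul]

theorem fNormSq_nonneg (σ : ℝ) (f : ℤ → ℝ) (w : ℕ) : 0 ≤ fNormSq σ f w := by
  unfold fNormSq
  positivity

theorem sum_fNormSq_one (f : ℤ → ℝ) (w : ℕ) :
    ∑ i ∈ Finset.range (w + 1), fNormSq 1 f i = bigF 1 f w := by
  simp only [fNormSq, bigF, one_pow, one_mul, sum_range_sum_range_succ (fun j => f j ^ 2)]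

theorem bigF_nonneg (σ : ℝ) (f : ℤ → ℝ) (w : ℕ) : 0 ≤ bigF σ f w := by
  rw [bigF_eq_sq_mul, ← sum_fNormSq_one]
  exact mul_nonneg (sq_nonneg σ) (Finset.sum_nonneg fun i _ => fNormSq_nonneg 1 f i)

theorem sum_sq_comp_sub_left_le (f : ℤ → ℝ) {a t : ℤ} (h : t - a ≤ w) :
    ∑ s ∈ Finset.Icc a t, f (t - s) ^ 2 ≤ fNormSq 1 f w := by
  simpa only [fNormSq, one_pow, one_mul] using
    sum_Icc_comp_sub_left_le (g := fun j => f j ^ 2) (n := w + 1) (fun _ => sq_nonneg _)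
      (by push_cast; omega)

theorem sum_sum_sq_comp_sub_le (f : ℤ → ℝ) {a b : ℤ} (h : b - a ≤ w) :
    ∑ t ∈ Finset.Icc a b, ∑ s ∈ Finset.Icc a t, f (t - s) ^ 2 ≤ bigF 1 f w :=
  calc ∑ t ∈ Finset.Icc a b, ∑ s ∈ Finset.Icc a t, f (t - s) ^ 2
      ≤ ∑ t ∈ Finset.Icc a b, fNormSq 1 f (t - a).toNat :=
        Finset.sum_le_sum fun t _ => sum_sq_comp_sub_left_le f (by omega)
    _ ≤ ∑ i ∈ Finset.range (w + 1), fNormSq 1 f (i : ℤ).toNat :=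
        sum_Icc_comp_sub_right_le (g := fun j => fNormSq 1 f j.toNat)
          (fun _ => fNormSq_nonneg _ _ _) (by push_cast; omega)
    _ = bigF 1 f w := by simp only [Int.toNat_natCast, sum_fNormSq_one]

end Windows

section PredictionError

variable {w T k : ℕ} {τ t : ℤ}

/-- The error `y_t - y_{t|τ-1}` of the prediction available at the start of a window that begins
at `τ ≤ t`, as a function of the noise: the initial predictions cancel. -/
noncomputable def predictionError (f e : ℤ → ℝ) (τ t : ℤ) : ℝ :=
  ∑ s ∈ Finset.Icc (max τ 1) t, f (t - s) * e s

theorem target_sub_prediction (f yhat e : ℤ → ℝ) (h : τ ≤ t) :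
    target f yhat e t - prediction f yhat e (τ - 1) t = predictionError f e τ t := by
  rw [target, prediction, predictionError, add_sub_add_left_eq_sub, sub_eq_iff_eq_add,
    ← Finset.sum_union]
  · refine Finset.sum_congr ?_ fun _ _ => rfl
    ext s
    simp only [Finset.mem_union, Finset.mem_Icc]
    omega
  · rw [Finset.disjoint_left]
    intro s
    simp only [Finset.mem_Icc]
    omega

theorem g2_eq_sum_predictionError_sq (w T : ℕ) (f yhat e : ℤ → ℝ) :
    g2 w T f yhat e = (1 / ((w : ℝ) + 1)) * ∑ k ∈ Finset.range (w + 1), ∑ τ ∈ startTimes w T k,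
      ∑ t ∈ windowSlots w T τ, (1 / 2) * predictionError f e τ t ^ 2 := by
  rw [g2]
  congr 1
  refine Finset.sum_congr rfl fun k _ => Finset.sum_congr rfl fun τ _ =>
    Finset.sum_congr rfl fun t ht => ?_
  rw [target_sub_prediction f yhat e (mem_windowSlots.1 ht).2.1]

theorem blockMatrix_mulVec_apply (f v : ℤ → ℝ) (hτ : τ ∈ startTimes w T k) (t : Slot T)
    (ht : (t : ℤ) ∈ windowSlots w T τ) :
    (blockMatrix w T f k).mulVec (fun s => v s) t = predictionError f v τ t := by
  rw [mem_windowSlots] at ht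
  have hentry : ∀ s : Slot T, blockMatrix w T f k t s =
      if τ ≤ (s : ℤ) ∧ (s : ℤ) ≤ t then f ((t : ℤ) - s) else 0 := by
    intro s
    simp only [blockMatrix, Matrix.of_apply]
    refine if_congr ⟨?_, fun h => ⟨τ, hτ, h.1, h.2, ht.2.2⟩⟩ rfl rfl
    rintro ⟨τ', hτ', hs, hst, htτ'⟩
    rw [startTime_unique hτ hτ' ht.2 ⟨hs.trans hst, htτ'⟩]
    exact ⟨hs, hst⟩
  simp only [Matrix.mulVec, dotProduct, hentry, ite_mul, zero_mul]
  rw [Finset.sum_coe_sort (Finset.Icc (1 : ℤ) T)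
    (fun s => if τ ≤ s ∧ s ≤ (t : ℤ) then f ((t : ℤ) - s) * v s else 0), ← Finset.sum_filter]
  refine Finset.sum_congr ?_ fun _ _ => rfl
  ext s
  simp only [Finset.mem_filter, Finset.mem_Icc]
  omega

theorem sum_blockMatrix_mulVec_sq (w T k : ℕ) (f v : ℤ → ℝ) :
    ∑ t, ((blockMatrix w T f k).mulVec (fun s => v s) t) ^ 2 =
      ∑ τ ∈ startTimes w T k, ∑ t ∈ windowSlots w T τ, predictionError f v τ t ^ 2 := by
  set h : ℤ → ℝ := Function.extend Subtype.val
    (fun t : Slot T => (blockMatrix w T f k).mulVec (fun s => v s) t ^ 2) 0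
  have hval : ∀ t : Slot T, h t = (blockMatrix w T f k).mulVec (fun s => v s) t ^ 2 :=
    Subtype.val_injective.extend_apply _ _
  simp only [← hval]
  rw [Finset.sum_coe_sort (Finset.Icc (1 : ℤ) T) h, ← sum_startTimes_sum_windowSlots w T k]
  refine Finset.sum_congr rfl fun τ hτ => Finset.sum_congr rfl fun t ht => ?_
  rw [← blockMatrix_mulVec_apply f v hτ ⟨t, Finset.mem_Icc.2 (mem_windowSlots.1 ht).1⟩ ht, ← hval]

theorem sum_stackedMatrix_mulVec_sq (w T : ℕ) (f v : ℤ → ℝ) :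
    ∑ i, ((stackedMatrix w T f).mulVec (fun s => v s) i) ^ 2 =
      (1 / ((w : ℝ) + 1)) * ∑ k ∈ Finset.range (w + 1), ∑ τ ∈ startTimes w T k,
        ∑ t ∈ windowSlots w T τ, predictionError f v τ t ^ 2 := by
  have hrow : ∀ (k : Fin (w + 1)) (t : Slot T),
      (stackedMatrix w T f).mulVec (fun s => v s) (k, t) =
        (blockMatrix w T f k).mulVec (fun s => v s) t / Real.sqrt ((w : ℝ) + 1) := fun k t => by
    simp only [Matrix.mulVec, dotProduct, stackedMatrix, Matrix.of_apply, Finset.sum_div,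
      div_mul_eq_mul_div]
  simp only [← sum_blockMatrix_mulVec_sq]
  rw [Finset.sum_range (fun k => ∑ t, ((blockMatrix w T f k).mulVec (fun s => v s) t) ^ 2),
    Fintype.sum_prod_type]
  simp only [hrow, div_pow, Real.sq_sqrt (show (0 : ℝ) ≤ (w : ℝ) + 1 by positivity),
    ← Finset.sum_div]
  ring

theorem g2_eq (w T : ℕ) (f yhat e : ℤ → ℝ) :
    g2 w T f yhat e = (1 / 2) * ∑ i, ((stackedMatrix w T f).mulVec (fun s => e s) i) ^ 2 := by
  simp only [g2_eq_sum_predictionError_sq, sum_stackedMatrix_mulVec_sq, ← Finset.mul_sum]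
  ring

theorem sum_windowSlots_predictionError_sq_le (f v : ℤ → ℝ) (w T : ℕ) (τ : ℤ) :
    ∑ t ∈ windowSlots w T τ, predictionError f v τ t ^ 2 ≤
      bigF 1 f w * ∑ s ∈ windowSlots w T τ, v s ^ 2 :=
  calc ∑ t ∈ windowSlots w T τ, predictionError f v τ t ^ 2
      ≤ ∑ t ∈ windowSlots w T τ, (∑ s ∈ Finset.Icc (max τ 1) t, f (t - s) ^ 2)
          * ∑ s ∈ windowSlots w T τ, v s ^ 2 := by
        refine Finset.sum_le_sum fun t ht => (Finset.sum_mul_sq_le_sq_mul_sq _ _ _).trans ?_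
        gcongr
        refine fun s hs => mem_windowSlots.2 ?_
        rw [mem_windowSlots] at ht
        rw [Finset.mem_Icc] at hs
        omega
    _ ≤ bigF 1 f w * ∑ s ∈ windowSlots w T τ, v s ^ 2 := by
        rw [← Finset.sum_mul]
        gcongr
        exact sum_sum_sq_comp_sub_le f (by omega)

theorem sum_stackedMatrix_mulVec_sq_le (w T : ℕ) (f : ℤ → ℝ) (u : Slot T → ℝ) :
    ∑ i, ((stackedMatrix w T f).mulVec u i) ^ 2 ≤ bigF 1 f w * ∑ s, u s ^ 2 := by
  obtain ⟨v, rfl⟩ : ∃ v : ℤ → ℝ, (fun s : Slot T => v s) = u :=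
    ⟨Function.extend Subtype.val u 0, funext (Subtype.val_injective.extend_apply u 0)⟩
  have hblock : ∀ k, ∑ τ ∈ startTimes w T k, ∑ t ∈ windowSlots w T τ, predictionError f v τ t ^ 2
      ≤ bigF 1 f w * ∑ s ∈ Finset.Icc (1 : ℤ) T, v s ^ 2 := fun k => by
    rw [← sum_startTimes_sum_windowSlots w T k, Finset.mul_sum]
    exact Finset.sum_le_sum fun τ _ => sum_windowSlots_predictionError_sq_le f v w T τ
  rw [sum_stackedMatrix_mulVec_sq, Finset.sum_coe_sort _ fun s => v s ^ 2, one_div,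
    inv_mul_le_iff₀ (by positivity)]
  simpa using Finset.sum_le_card_nsmul (Finset.range (w + 1)) _ _ fun k _ => hblock k

theorem topEigenvalue_le_bigF_one (w T : ℕ) (f : ℤ → ℝ) : topEigenvalue w T f ≤ bigF 1 f w :=
  Real.sSup_le (fun _ hx => le_of_mem_spectrum_mul_transpose (bigF_nonneg 1 f w)
    (sum_stackedMatrix_mulVec_sq_le w T f) hx) (bigF_nonneg 1 f w)

theorem topEigenvalue_le_bigF_div {σ : ℝ} (hσ : σ ≠ 0) (w T : ℕ) (f : ℤ → ℝ) :
    topEigenvalue w T f ≤ bigF σ f w / σ ^ 2 := by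
  rw [bigF_eq_sq_mul, mul_div_cancel_left₀ _ (pow_ne_zero 2 hσ)]
  exact topEigenvalue_le_bigF_one w T f

theorem topEigenvalue_pos (w : ℕ) (hT : 1 ≤ T) {f : ℤ → ℝ} (hf : f 0 ≠ 0) :
    0 < topEigenvalue w T f := by
  have h1T : (1 : ℤ) ≤ T := mod_cast hT
  obtain ⟨τ, hτ, hτ₁, hw⟩ := exists_startTime w T 0 le_rfl h1T
  let t : Slot T := ⟨1, Finset.mem_Icc.2 ⟨le_rfl, h1T⟩⟩
  refine sSup_spectrum_mul_transpose_pos (i := (0, t)) (j := t) ?_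
  simp only [stackedMatrix, blockMatrix, Matrix.of_apply]
  rw [if_pos ⟨τ, hτ, hτ₁, le_rfl, hw⟩, sub_self]
  positivity

end PredictionError

section CompetitiveDifference

variable {β : ℝ} {w T k : ℕ} {τ t : ℤ} {f yhat e x y v : ℤ → ℝ}

theorem IsFHC.cost_le (hβ : 0 ≤ β) (hx : IsFHC β w T k f yhat e x) (y : ℤ → ℝ)
    (hv : ∀ t ≤ 0, v t = 0) :
    cost β T y x ≤ cost β T y v + ∑ τ ∈ startTimes w T k, β * |v (τ - 1) - x (τ - 1)|
      + ∑ τ ∈ startTimes w T k, ∑ t ∈ windowSlots w T τ,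
          (1 / 2) * (y t - prediction f yhat e (τ - 1) t) ^ 2 := by
  have hsplit : ∀ u, cost β T y u = ∑ τ ∈ startTimes w T k,
      windowCost β y (max τ 1) (min (τ + w) T) u := fun u =>
    (sum_startTimes_sum_windowSlots w T k _).symm
  rw [hsplit, hsplit, ← Finset.sum_add_distrib, ← Finset.sum_add_distrib]
  refine Finset.sum_le_sum fun τ hτ => ((hx.2 τ hτ).windowCost_le_of_targets hβ y v).trans ?_
  have hstart : |x (max τ 1 - 1) - v (max τ 1 - 1)| ≤ |v (τ - 1) - x (τ - 1)| := by
    rcases le_total τ 1 with h | h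
    · rw [max_eq_right h, hv _ (by norm_num), hx.1 _ (by norm_num), sub_self, abs_zero]
      positivity
    · rw [max_eq_left h, abs_sub_comm]
  simp only [windowSlots]
  gcongr

theorem cost_afhc_le (hβ : 0 ≤ β) (w T : ℕ) (f yhat e y : ℤ → ℝ) :
    cost β T y (afhc β w T f yhat e) ≤
      (1 / ((w : ℝ) + 1)) * ∑ k ∈ Finset.range (w + 1), cost β T y (fhc β w T f yhat e k) := by
  have hafhc : afhc β w T f yhat e =
      ∑ k ∈ Finset.range (w + 1), (1 / ((w : ℝ) + 1)) • fhc β w T f yhat e k := by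
    ext t
    simp only [afhc, Finset.sum_apply, Pi.smul_apply, smul_eq_mul, Finset.mul_sum]
  rw [hafhc, Finset.mul_sum]
  exact (convexOn_windowCost hβ y 1 T).map_sum_le (fun _ _ => by positivity)
    (by simp [Nat.cast_add_one_ne_zero]) (fun _ _ => Set.mem_univ _)

theorem competitiveDifference_le (hβ : 0 ≤ β) (w T : ℕ) (f yhat e : ℤ → ℝ) :
    competitiveDifference β w T f yhat e ≤ g1 β w T f yhat e + g2 w T f yhat e := by
  set y := target f yhat e with hy
  have hfhc := Finset.sum_le_sum fun k (_ : k ∈ Finset.range (w + 1)) =>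
    (isFHC_fhc β hβ w T k f yhat e).cost_le hβ y (isOpt_opt β hβ T y).1
  rw [Finset.sum_add_distrib, Finset.sum_add_distrib, Finset.sum_const, Finset.card_range,
    nsmul_eq_mul] at hfhc
  have haverage := (cost_afhc_le hβ w T f yhat e y).trans
    (mul_le_mul_of_nonneg_left hfhc (by positivity))
  rw [mul_add, mul_add, Nat.cast_add_one, ← mul_assoc,
    one_div_mul_cancel (Nat.cast_add_one_ne_zero w), one_mul] at haverage
  rw [competitiveDifference, g1, g2, ← hy]
  linarith

theorem competitiveDifference_nonneg (hβ : 0 ≤ β) (w T : ℕ) (f yhat e : ℤ → ℝ) :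
    0 ≤ competitiveDifference β w T f yhat e := by
  have hopt := isOpt_opt β hβ T (target f yhat e)
  refine sub_nonneg.2 (hopt.2 _ ?_)
  have hzero : (1 : ℤ) - 1 ≤ 0 := by norm_num
  simp only [afhc, hopt.1 _ hzero, (isFHC_fhc β hβ w T _ f yhat e).1 _ hzero,
    Finset.sum_const_zero, mul_zero]

end CompetitiveDifference

section SwitchingTerm

variable {β : ℝ} {w T k : ℕ} {τ t : ℤ}

theorem abs_opt_sub_le (hβ : 0 ≤ β) (y : ℤ → ℝ) (ht₁ : 1 ≤ t) (htT : t ≤ T) :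
    |opt β T y t - y t| ≤ 2 * β := by
  have := (isOpt_opt β hβ T y).2.abs_sub_le hβ (Finset.mem_Icc.2 ⟨ht₁, htT⟩)
  split_ifs at this <;> linarith

theorem abs_fhc_sub_prediction_le (hβ : 0 ≤ β) (f yhat e : ℤ → ℝ) (hτ : τ ∈ startTimes w T k)
    (hτ₂ : 2 ≤ τ) :
    |fhc β w T f yhat e k (τ - 1) - prediction f yhat e (τ - 1 - w - 1) (τ - 1)| ≤ β := by
  have hmem := mem_startTimes.1 hτ
  have hprev : τ - 1 - w ∈ startTimes w T k := by
    refine mem_startTimes.2 ⟨⟨by omega, by omega⟩, Int.ModEq.trans ?_ hmem.2⟩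
    exact Int.modEq_iff_dvd.2 ⟨1, by ring⟩
  simpa using ((isFHC_fhc β hβ w T k f yhat e).2 _ hprev).abs_sub_le hβ (t := τ - 1)
    (Finset.mem_Icc.2 ⟨by omega, by omega⟩)

theorem abs_opt_sub_fhc_le (hβ : 0 ≤ β) (f yhat e : ℤ → ℝ) (hτ : τ ∈ startTimes w T k) :
    |opt β T (target f yhat e) (τ - 1) - fhc β w T f yhat e k (τ - 1)| ≤
      if 2 ≤ τ then 3 * β + |predictionError f e (τ - 1 - w) (τ - 1)| else 0 := by
  split_ifs with hτ₂
  · have hτT := (mem_startTimes.1 hτ).1.2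
    have hopt := abs_opt_sub_le hβ (target f yhat e) (T := T) (t := τ - 1) (by omega) (by omega)
    have hfhc := abs_fhc_sub_prediction_le hβ f yhat e hτ hτ₂
    rw [abs_sub_comm] at hfhc
    rw [← target_sub_prediction f yhat e (by omega)]
    have hvia := abs_sub_le (opt β T (target f yhat e) (τ - 1)) (target f yhat e (τ - 1))
      (fhc β w T f yhat e k (τ - 1))
    have hvia' := abs_sub_le (target f yhat e (τ - 1))
      (prediction f yhat e (τ - 1 - w - 1) (τ - 1)) (fhc β w T f yhat e k (τ - 1))
    linarith
  · rw [(isOpt_opt β hβ T _).1 _ (by omega), (isFHC_fhc β hβ w T k f yhat e).1 _ (by omega),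
      sub_self, abs_zero]

/-- The total size of the errors `y_t - y_{t|t-w-1}` committed at the last slots of the windows.
It carries all the randomness of the bound on `g₁`. -/
noncomputable def sumAbsError (f : ℤ → ℝ) (w T : ℕ) (e : ℤ → ℝ) : ℝ :=
  ∑ t ∈ Finset.Icc (1 : ℤ) T, |predictionError f e (t - w) t|

theorem g1_nonneg (hβ : 0 ≤ β) (w T : ℕ) (f yhat e : ℤ → ℝ) : 0 ≤ g1 β w T f yhat e := by
  unfold g1
  positivity

theorem g1_le (hβ : 0 ≤ β) (w T : ℕ) (f yhat e : ℤ → ℝ) :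
    g1 β w T f yhat e ≤
      3 * β ^ 2 * T / ((w : ℝ) + 1) + β / ((w : ℝ) + 1) * sumAbsError f w T e := by
  set h : ℤ → ℝ := fun t => 3 * β ^ 2 + β * |predictionError f e (t - w) t|
  have hterm : ∀ k, ∀ τ ∈ startTimes w T k,
      β * |opt β T (target f yhat e) (τ - 1) - fhc β w T f yhat e k (τ - 1)| ≤
        if 2 ≤ τ then h (τ - 1) else 0 := fun k τ hτ => by
    refine (mul_le_mul_of_nonneg_left (abs_opt_sub_fhc_le hβ f yhat e hτ) hβ).trans_eq ?_
    split_ifs <;> ring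
  have hshift : ∑ τ ∈ Finset.Icc (-(w : ℤ)) T with 2 ≤ τ, h (τ - 1) ≤
      ∑ t ∈ Finset.Icc (1 : ℤ) T, h t := by
    rw [← Finset.sum_image fun τ _ τ' _ hτ => sub_left_injective hτ]
    refine Finset.sum_le_sum_of_subset_of_nonneg (fun t ht => ?_) fun t _ _ => by positivity
    simp only [Finset.mem_image, Finset.mem_filter, Finset.mem_Icc] at ht ⊢
    omega
  calc g1 β w T f yhat e
      ≤ (1 / ((w : ℝ) + 1)) * ∑ k ∈ Finset.range (w + 1), ∑ τ ∈ startTimes w T k,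
          if 2 ≤ τ then h (τ - 1) else 0 := by
        rw [g1]
        gcongr with k _ τ hτ
        exact hterm k τ hτ
    _ ≤ (1 / ((w : ℝ) + 1)) * ∑ t ∈ Finset.Icc (1 : ℤ) T, h t := by
        rw [sum_range_sum_startTimes, ← Finset.sum_filter]
        gcongr
    _ = _ := by
        rw [Finset.sum_add_distrib, Finset.sum_const, Int.card_Icc, ← Finset.mul_sum, sumAbsError,
          nsmul_eq_mul, add_sub_cancel_right, Int.toNat_natCast]
        ring

end SwitchingTerm

section Continuity

variable {X : Type*} [TopologicalSpace X] {β : ℝ} {T : ℕ} {E : X → ℤ → ℝ}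

open Filter Topology in
theorem continuous_of_solvesWindow (hβ : 0 ≤ β) {a b : ℤ} {z x : X → ℤ → ℝ}
    (hx : ∀ p, SolvesWindow β (z p) a b (x p))
    (hz : ∀ t ∈ Finset.Icc a b, Continuous fun p => z p t)
    (hstart : Continuous fun p => x p (a - 1)) {t : ℤ} (ht : t ∈ Finset.Icc a b) :
    Continuous fun p => x p t := by
  rw [continuous_iff_continuousAt]
  intro p₀
  set bound : X → ℝ := fun p => ∑ t ∈ Finset.Icc a b, (z p t - z p₀ t) ^ 2
      + 4 * β * |x p (a - 1) - x p₀ (a - 1)|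
  have hbound : ∀ p, (x p t - x p₀ t) ^ 2 ≤ bound p := fun p =>
    (Finset.single_le_sum (f := fun t => (x p t - x p₀ t) ^ 2) (fun _ _ => sq_nonneg _) ht).trans
      ((hx p).sum_sq_sub_le hβ (hx p₀))
  have hcont : Continuous bound :=
    (continuous_finsetSum _ fun t ht => ((hz t ht).sub continuous_const).pow 2).add (by fun_prop)
  have hlim : Tendsto bound (𝓝 p₀) (𝓝 0) := by
    simpa [bound] using hcont.tendsto p₀
  have habs := (squeeze_zero (fun p => sq_nonneg _) hbound hlim).sqrt
  simp only [Real.sqrt_sq_eq_abs, Real.sqrt_zero] at habs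
  exact tendsto_sub_nhds_zero_iff.1 ((tendsto_zero_iff_abs_tendsto_zero _).2 habs)

theorem continuous_prediction (hE : ∀ s ∈ Finset.Icc (1 : ℤ) T, Continuous fun p => E p s)
    (f yhat : ℤ → ℝ) {τ : ℤ} (hτ : τ ≤ T) (t : ℤ) :
    Continuous fun p => prediction f yhat (E p) τ t :=
  continuous_const.add <| continuous_finsetSum _ fun s hs => continuous_const.mul <|
    hE s (Finset.Icc_subset_Icc_right hτ hs)

theorem continuous_target (hE : ∀ s ∈ Finset.Icc (1 : ℤ) T, Continuous fun p => E p s)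
    (f yhat : ℤ → ℝ) {t : ℤ} (ht : t ≤ T) : Continuous fun p => target f yhat (E p) t :=
  continuous_prediction hE f yhat ht t

theorem continuous_opt (hE : ∀ s ∈ Finset.Icc (1 : ℤ) T, Continuous fun p => E p s)
    (hβ : 0 ≤ β) (f yhat : ℤ → ℝ) {t : ℤ} (ht : t ≤ T) :
    Continuous fun p => opt β T (target f yhat (E p)) t := by
  have hopt := fun p => isOpt_opt β hβ T (target f yhat (E p))
  have hinit : ∀ t ≤ 0, Continuous fun p => opt β T (target f yhat (E p)) t := fun t ht => by
    simpa only [fun p => (hopt p).1 t ht] using continuous_const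
  rcases le_or_gt t 0 with h | h
  · exact hinit t h
  · exact continuous_of_solvesWindow hβ (fun p => (hopt p).2)
      (fun t ht => continuous_target hE f yhat (Finset.mem_Icc.1 ht).2) (hinit _ (by norm_num))
      (Finset.mem_Icc.2 ⟨h, ht⟩)

theorem continuous_fhc (hE : ∀ s ∈ Finset.Icc (1 : ℤ) T, Continuous fun p => E p s)
    (hβ : 0 ≤ β) (w : ℕ) (f yhat : ℤ → ℝ) (k : ℕ) {t : ℤ} (ht : t ≤ T) :
    Continuous fun p => fhc β w T f yhat (E p) k t := by
  have hfhc := fun p => isFHC_fhc β hβ w T k f yhat (E p)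
  have hprefix : ∀ n : ℕ, ∀ t : ℤ, t ≤ n → t ≤ T →
      Continuous fun p => fhc β w T f yhat (E p) k t := by
    intro n
    induction n with
    | zero =>
      intro t ht _
      simpa only [fun p => (hfhc p).1 t ht] using continuous_const
    | succ n ih =>
      intro t ht hT
      rcases le_or_gt t n with h | h
      · exact ih t h hT
      · obtain ⟨τ, hτ, hτt, htτ⟩ := exists_startTime w T k (by omega : 1 ≤ t) hT
        push_cast at ht
        exact continuous_of_solvesWindow hβ (fun p => (hfhc p).2 τ hτ)
          (fun t _ => continuous_prediction hE f yhat (by omega) t)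
          (ih _ (by omega) (by omega)) (Finset.mem_Icc.2 ⟨by omega, by omega⟩)
  exact hprefix t.toNat t (by omega) ht

theorem continuous_g1 (hE : ∀ s ∈ Finset.Icc (1 : ℤ) T, Continuous fun p => E p s)
    (hβ : 0 ≤ β) (w : ℕ) (f yhat : ℤ → ℝ) : Continuous fun p => g1 β w T f yhat (E p) := by
  refine continuous_const.mul <| continuous_finsetSum _ fun k _ =>
    continuous_finsetSum _ fun τ hτ => continuous_const.mul ?_
  have hτT := (mem_startTimes.1 hτ).1.2
  exact ((continuous_opt hE hβ f yhat (by omega)).sub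
    (continuous_fhc hE hβ w f yhat k (by omega))).abs

theorem continuous_cost (β : ℝ) {y x : X → ℤ → ℝ}
    (hy : ∀ t ≤ (T : ℤ), Continuous fun p => y p t)
    (hx : ∀ t ≤ (T : ℤ), Continuous fun p => x p t) :
    Continuous fun p => cost β T (y p) (x p) := by
  unfold cost windowCost
  refine continuous_finsetSum _ fun t ht => ?_
  have htT := (Finset.mem_Icc.1 ht).2
  have := hy t htT
  have := hx t htT
  have := hx (t - 1) (by omega)
  fun_prop

theorem continuous_competitiveDifference
    (hE : ∀ s ∈ Finset.Icc (1 : ℤ) T, Continuous fun p => E p s)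
    (hβ : 0 ≤ β) (w : ℕ) (f yhat : ℤ → ℝ) :
    Continuous fun p => competitiveDifference β w T f yhat (E p) :=
  have hy := fun t (ht : t ≤ (T : ℤ)) => continuous_target hE f yhat ht
  (continuous_cost β hy fun _ ht => continuous_const.mul <|
    continuous_finsetSum _ fun k _ => continuous_fhc hE hβ w f yhat k ht).sub
    (continuous_cost β hy fun _ ht => continuous_opt hE hβ f yhat ht)

end Continuity

section SumAbsError

variable {w T : ℕ} {s τ t : ℤ} {f v v' : ℤ → ℝ}

theorem predictionError_congr (h : ∀ s, 1 ≤ s → s ≤ t → v s = v' s) :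
    predictionError f v τ t = predictionError f v' τ t :=
  Finset.sum_congr rfl fun s hs => by
    rw [Finset.mem_Icc] at hs
    rw [h s (by omega) hs.2]

theorem sumAbsError_congr (h : ∀ s ∈ Finset.Icc (1 : ℤ) T, v s = v' s) :
    sumAbsError f w T v = sumAbsError f w T v' :=
  Finset.sum_congr rfl fun t ht => by
    rw [predictionError_congr fun s hs hst =>
      h s (Finset.mem_Icc.2 ⟨hs, hst.trans (Finset.mem_Icc.1 ht).2⟩)]

theorem abs_predictionError_sub_le (h : ∀ i, 1 ≤ i → i ≤ t → i ≠ s → v i = v' i) :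
    |predictionError f v τ t - predictionError f v' τ t| ≤
      if τ ≤ s ∧ s ≤ t then |f (t - s)| * |v s - v' s| else 0 := by
  have hterm : ∀ i ∈ Finset.Icc (max τ 1) t,
      f (t - i) * v i - f (t - i) * v' i = if i = s then f (t - s) * (v s - v' s) else 0 := by
    intro i hi
    rw [Finset.mem_Icc] at hi
    split_ifs with his
    · rw [his, mul_sub]
    · rw [h i (by omega) hi.2 his, sub_self]
  rw [predictionError, predictionError, ← Finset.sum_sub_distrib, Finset.sum_congr rfl hterm,
    Finset.sum_ite_eq', ← abs_mul]
  simp only [Finset.mem_Icc, max_le_iff]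
  split_ifs with hmem hs hs
  · exact le_rfl
  · exact absurd ⟨hmem.1.1, hmem.2⟩ hs
  · rw [abs_zero]
    positivity
  · rw [abs_zero]

theorem sum_abs_le_sqrt (f : ℤ → ℝ) (w : ℕ) :
    ∑ j ∈ Finset.range (w + 1), |f j| ≤ Real.sqrt (((w : ℝ) + 1) * fNormSq 1 f w) := by
  refine Real.le_sqrt_of_sq_le ?_
  simpa [fNormSq] using
    sq_sum_le_card_mul_sum_sq (s := Finset.range (w + 1)) (f := fun j : ℕ => |f j|)

theorem abs_sumAbsError_sub_le (h : ∀ i ∈ Finset.Icc (1 : ℤ) T, i ≠ s → v i = v' i) :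
    |sumAbsError f w T v - sumAbsError f w T v'| ≤
      Real.sqrt (((w : ℝ) + 1) * fNormSq 1 f w) * |v s - v' s| :=
  calc |sumAbsError f w T v - sumAbsError f w T v'|
      ≤ ∑ t ∈ Finset.Icc (1 : ℤ) T,
          |predictionError f v (t - w) t - predictionError f v' (t - w) t| := by
        rw [sumAbsError, sumAbsError, ← Finset.sum_sub_distrib]
        exact (Finset.abs_sum_le_sum_abs _ _).trans
          (Finset.sum_le_sum fun t _ => abs_abs_sub_abs_le_abs_sub _ _)
    _ ≤ ∑ t ∈ Finset.Icc (1 : ℤ) T,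
          if t - w ≤ s ∧ s ≤ t then |f (t - s)| * |v s - v' s| else 0 :=
        Finset.sum_le_sum fun t ht => abs_predictionError_sub_le fun i hi hit =>
          h i (Finset.mem_Icc.2 ⟨hi, hit.trans (Finset.mem_Icc.1 ht).2⟩)
    _ ≤ ∑ t ∈ Finset.Icc s (s + w), |f (t - s)| * |v s - v' s| := by
        rw [← Finset.sum_filter]
        refine Finset.sum_le_sum_of_subset_of_nonneg (fun t ht => ?_) fun t _ _ => by positivity
        rw [Finset.mem_filter] at ht
        rw [Finset.mem_Icc]
        omega
    _ ≤ Real.sqrt (((w : ℝ) + 1) * fNormSq 1 f w) * |v s - v' s| := by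
        rw [← Finset.sum_mul]
        gcongr
        exact (sum_Icc_comp_sub_right_le (g := fun j => |f j|) (n := w + 1) (fun _ => abs_nonneg _)
          (by push_cast; omega)).trans (sum_abs_le_sqrt f w)

theorem sum_Icc_sum_windowSlots_sum_sq_le (f : ℤ → ℝ) (w T : ℕ) :
    ∑ τ ∈ Finset.Icc (-(w : ℤ)) T, ∑ t ∈ windowSlots w T τ,
      ∑ s ∈ Finset.Icc (max τ 1) t, f (t - s) ^ 2 ≤ T * bigF 1 f w := by
  have hcomm := Finset.sum_comm' (s := Finset.Icc (-(w : ℤ)) T) (t := windowSlots w T)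
    (t' := Finset.Icc (1 : ℤ) T) (s' := fun t => Finset.Icc (t - w) t)
    (f := fun τ t => ∑ s ∈ Finset.Icc (max τ 1) t, f (t - s) ^ 2) fun τ t => by
      simp only [mem_windowSlots, Finset.mem_Icc]
      omega
  have hslot : ∀ t : ℤ, ∑ τ ∈ Finset.Icc (t - w) t, ∑ s ∈ Finset.Icc (max τ 1) t, f (t - s) ^ 2 ≤
      bigF 1 f w := fun t =>
    calc ∑ τ ∈ Finset.Icc (t - w) t, ∑ s ∈ Finset.Icc (max τ 1) t, f (t - s) ^ 2
        ≤ ∑ τ ∈ Finset.Icc (t - w) t, fNormSq 1 f (t - τ).toNat :=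
          Finset.sum_le_sum fun τ _ => sum_sq_comp_sub_left_le f (by omega)
      _ ≤ ∑ i ∈ Finset.range (w + 1), fNormSq 1 f (i : ℤ).toNat :=
          sum_Icc_comp_sub_left_le (g := fun j => fNormSq 1 f j.toNat)
            (fun _ => fNormSq_nonneg _ _ _) (by push_cast; omega)
      _ = bigF 1 f w := by simp only [Int.toNat_natCast, sum_fNormSq_one]
  rw [hcomm]
  simpa using Finset.sum_le_card_nsmul (Finset.Icc (1 : ℤ) T) _ _ fun t _ => hslot t

end SumAbsError

section Noise

open scoped Topology

variable {Ω : Type*}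

/-- The coarsest topology on `Ω` that makes `e 1, …, e T` continuous. A quantity that depends
continuously on the noise path is continuous for it, hence measurable, and no separate argument is
needed that it depends on these `T` variables only. -/
abbrev noiseTopology (T : ℕ) (e : ℤ → Ω → ℝ) : TopologicalSpace Ω :=
  .induced (fun ω (s : Slot T) => e s ω) inferInstance

theorem continuous_noise {T : ℕ} (e : ℤ → Ω → ℝ) : ∀ s ∈ Finset.Icc (1 : ℤ) T,
    Continuous[noiseTopology T e, inferInstance] fun ω => e s ω := fun s hs =>
  let : TopologicalSpace Ω := noiseTopology T e
  (continuous_apply (⟨s, hs⟩ : Slot T)).comp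
    (continuous_induced_dom (f := fun ω (s : Slot T) => e s ω))

variable [MeasurableSpace Ω] {μ : Measure Ω}

theorem aemeasurable_of_continuous_induced {Y : Type*} [TopologicalSpace Y] [MeasurableSpace Y]
    [BorelSpace Y] {r : Ω → Y} (hr : AEMeasurable r μ) {φ : Ω → ℝ}
    (hφ : Continuous[.induced r inferInstance, inferInstance] φ) : AEMeasurable φ μ := by
  have hmeas : Measurable[MeasurableSpace.comap r inferInstance] φ := by
    rw [‹BorelSpace Y›.measurable_eq, ← borel_comap]
    let : TopologicalSpace Ω := .induced r inferInstance
    exact hφ.borel_measurable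
  obtain ⟨g, hg, rfl⟩ := hmeas.exists_eq_measurable_comp
  exact hg.comp_aemeasurable hr

/-- The stochastic assumptions on the noise: `e 1, …, e T` are independent, centred, of variance
`σ²` and almost surely bounded by `ε`. -/
structure IsNoise (μ : Measure Ω) (T : ℕ) (σ ε : ℝ) (e : ℤ → Ω → ℝ) : Prop where
  indep : iIndepFun (fun s : Slot T => e s) μ
  aemeasurable : ∀ s ∈ Finset.Icc (1 : ℤ) T, AEMeasurable (e s) μ
  mean : ∀ s ∈ Finset.Icc (1 : ℤ) T, ∫ ω, e s ω ∂μ = 0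
  variance : ∀ s ∈ Finset.Icc (1 : ℤ) T, ∫ ω, e s ω ^ 2 ∂μ = σ ^ 2
  bound : ∀ s ∈ Finset.Icc (1 : ℤ) T, ∀ᵐ ω ∂μ, |e s ω| ≤ ε

variable {T w : ℕ} {β σ ε u : ℝ} {e : ℤ → Ω → ℝ} {f yhat : ℤ → ℝ} {s τ t : ℤ}

theorem IsNoise.aemeasurable_of_continuous (he : IsNoise μ T σ ε e) {φ : Ω → ℝ}
    (hφ : Continuous[noiseTopology T e, inferInstance] φ) : AEMeasurable φ μ :=
  aemeasurable_of_continuous_induced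
    (aemeasurable_pi_lambda _ fun s : Slot T => he.aemeasurable s s.2) hφ

theorem IsNoise.aemeasurable_g1 (he : IsNoise μ T σ ε e) (hβ : 0 ≤ β) (w : ℕ) (f yhat : ℤ → ℝ) :
    AEMeasurable (fun ω => g1 β w T f yhat fun s => e s ω) μ :=
  let : TopologicalSpace Ω := noiseTopology T e
  he.aemeasurable_of_continuous (continuous_g1 (continuous_noise e) hβ w f yhat)

theorem IsNoise.aemeasurable_competitiveDifference (he : IsNoise μ T σ ε e) (hβ : 0 ≤ β) (w : ℕ)
    (f yhat : ℤ → ℝ) :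
    AEMeasurable (fun ω => competitiveDifference β w T f yhat fun s => e s ω) μ :=
  let : TopologicalSpace Ω := noiseTopology T e
  he.aemeasurable_of_continuous (continuous_competitiveDifference (continuous_noise e) hβ w f yhat)

theorem IsNoise.bound_pos (he : IsNoise μ T σ ε e) (hT : 1 ≤ T)
    (hσ : σ ≠ 0) : 0 < ε := by
  have h₁ : (1 : ℤ) ∈ Finset.Icc (1 : ℤ) T := by simpa using hT
  have := he.indep.isProbabilityMeasure
  by_contra! hε
  have hzero : ∀ᵐ ω ∂μ, e 1 ω ^ 2 = 0 := by
    filter_upwards [he.bound 1 h₁] with ω hω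
    rw [abs_nonpos_iff.1 (hω.trans hε), zero_pow two_ne_zero]
  exact pow_ne_zero 2 hσ <| by rw [← he.variance 1 h₁, integral_eq_zero_of_ae hzero]

theorem integral_abs_le_sqrt_integral_sq [IsProbabilityMeasure μ] {X : Ω → ℝ} (hX : MemLp X 2 μ) :
    ∫ ω, |X ω| ∂μ ≤ Real.sqrt (∫ ω, X ω ^ 2 ∂μ) := by
  refine Real.le_sqrt_of_sq_le (sub_nonneg.1 ?_)
  simpa only [variance_eq_sub hX.abs, sq_abs, Pi.pow_apply, Pi.abs_apply] using
    variance_nonneg |X| μ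

theorem IsNoise.memLp (he : IsNoise μ T σ ε e) (hs : s ∈ Finset.Icc (1 : ℤ) T) :
    MemLp (e s) 2 μ :=
  have := he.indep.isProbabilityMeasure
  .of_bound (he.aemeasurable s hs).aestronglyMeasurable ε (he.bound s hs)

theorem IsNoise.memLp_predictionError (he : IsNoise μ T σ ε e) (f : ℤ → ℝ) (τ : ℤ) (ht : t ≤ T) :
    MemLp (fun ω => predictionError f (fun s => e s ω) τ t) 2 μ :=
  memLp_finsetSum _ fun s hs => (he.memLp (s := s) (by
    rw [Finset.mem_Icc] at hs ⊢
    omega)).const_mul _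

theorem IsNoise.integral_predictionError_sq (he : IsNoise μ T σ ε e) (f : ℤ → ℝ) (τ : ℤ)
    (ht : t ≤ T) :
    ∫ ω, predictionError f (fun s => e s ω) τ t ^ 2 ∂μ =
      σ ^ 2 * ∑ s ∈ Finset.Icc (max τ 1) t, f (t - s) ^ 2 := by
  have := he.indep.isProbabilityMeasure
  have hslot : ∀ s ∈ Finset.Icc (max τ 1) t, s ∈ Finset.Icc (1 : ℤ) T := fun s hs => by
    rw [Finset.mem_Icc] at hs ⊢
    omega
  have hvar : ∀ s ∈ Finset.Icc (max τ 1) t,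
      Var[fun ω => f (t - s) * e s ω; μ] = σ ^ 2 * f (t - s) ^ 2 := fun s hs => by
    have hs := hslot s hs
    rw [variance_const_mul, variance_of_integral_eq_zero (he.aemeasurable s hs) (he.mean s hs),
      he.variance s hs, mul_comm]
  have hmean : ∫ ω, predictionError f (fun s => e s ω) τ t ∂μ = 0 := by
    unfold predictionError
    rw [integral_finsetSum _ fun s hs =>
      ((he.memLp (hslot s hs)).integrable one_le_two).const_mul _]
    exact Finset.sum_eq_zero fun s hs => by
      rw [integral_const_mul, he.mean s (hslot s hs), mul_zero]
  rw [← variance_of_integral_eq_zero (he.memLp_predictionError f τ ht).aemeasurable hmean]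
  have hpair : Set.Pairwise (Finset.Icc (max τ 1) t : Set ℤ)
      fun s s' => (fun ω => f (t - s) * e s ω) ⟂ᵢ[μ] fun ω => f (t - s') * e s' ω :=
    fun s hs s' hs' hne =>
      (he.indep.indepFun (i := ⟨s, hslot s hs⟩) (j := ⟨s', hslot s' hs'⟩) (by simpa using hne)).comp
        (measurable_const_mul (f (t - s))) (measurable_const_mul (f (t - s')))
  have hsum := IndepFun.variance_sum (fun s hs => (he.memLp (hslot s hs)).const_mul _) hpair
  rw [Finset.sum_congr rfl hvar, ← Finset.mul_sum, Finset.sum_fn] at hsum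
  exact hsum

end Noise

section Moments

variable {Ω : Type*} [MeasurableSpace Ω] {μ : Measure Ω} {T w : ℕ} {β σ ε u : ℝ} {e : ℤ → Ω → ℝ}
  {t : ℤ}

theorem IsNoise.integral_abs_predictionError_le (he : IsNoise μ T σ ε e) (f : ℤ → ℝ) (w : ℕ)
    (ht : t ≤ T) :
    ∫ ω, |predictionError f (fun s => e s ω) (t - w) t| ∂μ ≤ Real.sqrt (fNormSq σ f w) := by
  have := he.indep.isProbabilityMeasure
  refine (integral_abs_le_sqrt_integral_sq (he.memLp_predictionError f _ ht)).trans ?_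
  rw [he.integral_predictionError_sq f _ ht, fNormSq_eq_sq_mul]
  gcongr
  exact sum_sq_comp_sub_left_le f (by omega)

theorem IsNoise.integrable_abs_predictionError (he : IsNoise μ T σ ε e) (f : ℤ → ℝ) (w : ℕ) :
    ∀ t ∈ Finset.Icc (1 : ℤ) T,
      Integrable (fun ω => |predictionError f (fun s => e s ω) (t - w) t|) μ := fun t ht =>
  have := he.indep.isProbabilityMeasure
  ((he.memLp_predictionError f (t - w) (Finset.mem_Icc.1 ht).2).integrable one_le_two).abs

theorem IsNoise.integrable_sumAbsError (he : IsNoise μ T σ ε e) (f : ℤ → ℝ) (w : ℕ) :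
    Integrable (fun ω => sumAbsError f w T fun s => e s ω) μ :=
  integrable_finsetSum _ (he.integrable_abs_predictionError f w)

theorem IsNoise.integral_sumAbsError_le (he : IsNoise μ T σ ε e) (f : ℤ → ℝ) (w : ℕ) :
    ∫ ω, sumAbsError f w T (fun s => e s ω) ∂μ ≤ T * Real.sqrt (fNormSq σ f w) := by
  unfold sumAbsError
  rw [integral_finsetSum _ (he.integrable_abs_predictionError f w)]
  simpa using Finset.sum_le_card_nsmul (Finset.Icc (1 : ℤ) T) _ _ fun t ht =>
    he.integral_abs_predictionError_le f w (Finset.mem_Icc.1 ht).2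

theorem IsNoise.integrable_g1 (he : IsNoise μ T σ ε e) (hβ : 0 ≤ β) (w : ℕ) (f yhat : ℤ → ℝ) :
    Integrable (fun ω => g1 β w T f yhat fun s => e s ω) μ := by
  have := he.indep.isProbabilityMeasure
  refine ((integrable_const (3 * β ^ 2 * T / ((w : ℝ) + 1))).add
    ((he.integrable_sumAbsError f w).const_mul (β / ((w : ℝ) + 1)))).mono'
    (he.aemeasurable_g1 hβ w f yhat).aestronglyMeasurable (ae_of_all _ fun ω => ?_)
  rw [Real.norm_of_nonneg (g1_nonneg hβ w T f yhat _)]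
  exact g1_le hβ w T f yhat _

theorem IsNoise.integral_g1_le (he : IsNoise μ T σ ε e) (hβ : 0 ≤ β) (w : ℕ) (f yhat : ℤ → ℝ) :
    ∫ ω, g1 β w T f yhat (fun s => e s ω) ∂μ ≤ V1 β σ f w T := by
  have := he.indep.isProbabilityMeasure
  have hint := (he.integrable_sumAbsError f w).const_mul (β / ((w : ℝ) + 1))
  calc ∫ ω, g1 β w T f yhat (fun s => e s ω) ∂μ
      ≤ ∫ ω, (3 * β ^ 2 * T / ((w : ℝ) + 1)
          + β / ((w : ℝ) + 1) * sumAbsError f w T fun s => e s ω) ∂μ :=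
        integral_mono (he.integrable_g1 hβ w f yhat) ((integrable_const _).add hint)
          fun ω => g1_le hβ w T f yhat _
    _ = 3 * β ^ 2 * T / ((w : ℝ) + 1)
          + β / ((w : ℝ) + 1) * ∫ ω, sumAbsError f w T (fun s => e s ω) ∂μ := by
        rw [integral_add (integrable_const _) hint, integral_const, probReal_univ, one_smul,
          integral_const_mul]
    _ ≤ 3 * β ^ 2 * T / ((w : ℝ) + 1)
          + β / ((w : ℝ) + 1) * (T * Real.sqrt (fNormSq σ f w)) := by
        gcongr
        exact he.integral_sumAbsError_le f w
    _ = V1 β σ f w T := by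
        rw [V1]
        ring

theorem IsNoise.integrable_predictionError_sq (he : IsNoise μ T σ ε e) (f : ℤ → ℝ) {τ : ℤ} :
    ∀ t ∈ windowSlots w T τ,
      Integrable (fun ω => (1 / 2) * predictionError f (fun s => e s ω) τ t ^ 2) μ := fun _ ht =>
  (he.memLp_predictionError f τ (mem_windowSlots.1 ht).1.2).integrable_sq.const_mul _

theorem IsNoise.integrable_g2 (he : IsNoise μ T σ ε e) (w : ℕ) (f yhat : ℤ → ℝ) :
    Integrable (fun ω => g2 w T f yhat fun s => e s ω) μ := by
  simp only [g2_eq_sum_predictionError_sq]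
  exact (integrable_finsetSum _ fun k _ => integrable_finsetSum _ fun τ _ =>
    integrable_finsetSum _ (he.integrable_predictionError_sq f)).const_mul _

theorem IsNoise.integral_sum_windowSlots_eq (he : IsNoise μ T σ ε e) (f : ℤ → ℝ) (w : ℕ) (τ : ℤ) :
    ∫ ω, ∑ t ∈ windowSlots w T τ, (1 / 2) * predictionError f (fun s => e s ω) τ t ^ 2 ∂μ =
      σ ^ 2 / 2 * ∑ t ∈ windowSlots w T τ, ∑ s ∈ Finset.Icc (max τ 1) t, f (t - s) ^ 2 := by
  rw [integral_finsetSum _ (he.integrable_predictionError_sq f), Finset.mul_sum]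
  refine Finset.sum_congr rfl fun t ht => ?_
  rw [integral_const_mul, he.integral_predictionError_sq f τ (mem_windowSlots.1 ht).1.2]
  ring

theorem IsNoise.integral_g2_le (he : IsNoise μ T σ ε e) (w : ℕ) (f yhat : ℤ → ℝ) :
    ∫ ω, g2 w T f yhat (fun s => e s ω) ∂μ ≤ V2 σ f w T := by
  have hint : ∀ τ, Integrable (fun ω => ∑ t ∈ windowSlots w T τ,
      (1 / 2) * predictionError f (fun s => e s ω) τ t ^ 2) μ := fun τ =>
    integrable_finsetSum _ (he.integrable_predictionError_sq f)
  simp only [g2_eq_sum_predictionError_sq, sum_range_sum_startTimes]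
  rw [integral_const_mul, integral_finsetSum _ fun τ _ => hint τ]
  simp only [he.integral_sum_windowSlots_eq]
  rw [← Finset.mul_sum]
  calc (1 / ((w : ℝ) + 1)) * (σ ^ 2 / 2 * ∑ τ ∈ Finset.Icc (-(w : ℤ)) T,
        ∑ t ∈ windowSlots w T τ, ∑ s ∈ Finset.Icc (max τ 1) t, f (t - s) ^ 2)
      ≤ (1 / ((w : ℝ) + 1)) * (σ ^ 2 / 2 * (T * bigF 1 f w)) := by
        gcongr
        exact sum_Icc_sum_windowSlots_sum_sq_le f w T
    _ = V2 σ f w T := by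
        rw [V2, bigF_eq_sq_mul σ]
        field_simp

theorem IsNoise.integrable_competitiveDifference (he : IsNoise μ T σ ε e) (hβ : 0 ≤ β) (w : ℕ)
    (f yhat : ℤ → ℝ) :
    Integrable (fun ω => competitiveDifference β w T f yhat fun s => e s ω) μ := by
  refine ((he.integrable_g1 hβ w f yhat).add (he.integrable_g2 w f yhat)).mono'
    (he.aemeasurable_competitiveDifference hβ w f yhat).aestronglyMeasurable
    (ae_of_all _ fun ω => ?_)
  rw [Real.norm_of_nonneg (competitiveDifference_nonneg hβ w T f yhat _)]
  exact competitiveDifference_le hβ w T f yhat _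

theorem IsNoise.integral_competitiveDifference_le (he : IsNoise μ T σ ε e) (hβ : 0 ≤ β) (w : ℕ)
    (f yhat : ℤ → ℝ) :
    ∫ ω, competitiveDifference β w T f yhat (fun s => e s ω) ∂μ ≤ V1 β σ f w T + V2 σ f w T := by
  refine (integral_mono (he.integrable_competitiveDifference hβ w f yhat)
    ((he.integrable_g1 hβ w f yhat).add (he.integrable_g2 w f yhat))
    fun ω => competitiveDifference_le hβ w T f yhat _).trans ?_
  rw [integral_add' (he.integrable_g1 hβ w f yhat) (he.integrable_g2 w f yhat)]
  exact add_le_add (he.integral_g1_le hβ w f yhat) (he.integral_g2_le w f yhat)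

end Moments

section Tails

variable {Ω : Type*} [MeasurableSpace Ω] {μ : Measure Ω} {T w : ℕ} {β σ ε u : ℝ} {e : ℤ → Ω → ℝ}
  {f : ℤ → ℝ}

theorem fNormSq_pos (hσ : σ ≠ 0) (hf : f 0 ≠ 0) (w : ℕ) : 0 < fNormSq σ f w :=
  mul_pos (by positivity) <| Finset.sum_pos' (fun _ _ => sq_nonneg _)
    ⟨0, by simp, by simpa using sq_pos_of_ne_zero hf⟩

theorem bigF_pos (hσ : σ ≠ 0) (hf : f 0 ≠ 0) (w : ℕ) : 0 < bigF σ f w := by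
  rw [bigF_eq_sq_mul, ← sum_fNormSq_one]
  exact mul_pos (by positivity) <| Finset.sum_pos (fun i _ => fNormSq_pos one_ne_zero hf i)
    Finset.nonempty_range_add_one

theorem continuous_sumAbsError_extend (f : ℤ → ℝ) (w T : ℕ) :
    Continuous fun x : Slot T → ℝ => sumAbsError f w T (Function.extend Subtype.val x 0) := by
  refine continuous_finsetSum _ fun t ht => (continuous_finsetSum _ fun s hs =>
    continuous_const.mul ?_).abs
  rw [Finset.mem_Icc] at ht hs
  obtain ⟨i, rfl⟩ : ∃ i : Slot T, i = s := ⟨⟨s, Finset.mem_Icc.2 ⟨by omega, by omega⟩⟩, rfl⟩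
  simpa only [Subtype.val_injective.extend_apply] using continuous_apply i

theorem IsNoise.measureReal_sumAbsError_ge_le (he : IsNoise μ T σ ε e) (hε : 0 ≤ ε)
    (f : ℤ → ℝ) (w : ℕ) (hu : 0 ≤ u) :
    μ.real {ω | T * Real.sqrt (fNormSq σ f w) + u ≤ sumAbsError f w T fun s => e s ω} ≤
      Real.exp (-u ^ 2 /
        (2 * ε ^ 2 * (T * (((w : ℝ) + 1) * fNormSq 1 f w)))) := by
  set y : (Slot T → ℝ) → ℝ := fun x => sumAbsError f w T (Function.extend Subtype.val x 0)
  have hval : ∀ (x : Slot T → ℝ) (i : Slot T), Function.extend Subtype.val x 0 (i : ℤ) = x i :=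
    fun x => Subtype.val_injective.extend_apply x 0
  have hy : ∀ ω, y (fun s => e s ω) = sumAbsError f w T fun s => e s ω := fun ω =>
    sumAbsError_congr fun s hs => hval (fun s => e s ω) ⟨s, hs⟩
  have hlip : ∀ i x r, |y x - y (Function.update x i r)| ≤
      Real.sqrt (((w : ℝ) + 1) * fNormSq 1 f w) * |x i - r| := fun i x r => by
    refine (abs_sumAbsError_sub_le (s := i) fun j hj hne => ?_).trans_eq ?_
    · lift j to Slot T using hj
      rw [hval, hval, Function.update_of_ne (Subtype.coe_ne_coe.1 hne)]
    · rw [hval, hval, Function.update_self]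
  have htail := measureReal_ge_le_exp_of_abs_sub_update_le_mul he.indep
    (fun i => he.aemeasurable i i.2) hε (fun i => he.bound i i.2)
    (continuous_sumAbsError_extend f w T).measurable
    (fun _ => Real.sqrt_nonneg _) hlip
    ((integral_congr_ae (ae_of_all _ hy)).trans_le (he.integral_sumAbsError_le f w)) hu
  have hsq := Real.sq_sqrt (mul_nonneg (by positivity : 0 ≤ (w : ℝ) + 1) (fNormSq_nonneg 1 f w))
  have hcard : (Finset.univ : Finset (Slot T)).card = T := by simp
  rw [Finset.sum_const, hsq, hcard, nsmul_eq_mul] at htail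
  simpa only [← hy] using htail

theorem IsNoise.measureReal_g1_gt_le (he : IsNoise μ T σ ε e) (hβ : 0 < β) (hσ : σ ≠ 0)
    (hε : 0 ≤ ε) (w : ℕ) (f yhat : ℤ → ℝ) (hu : 0 ≤ u) :
    μ.real {ω | g1 β w T f yhat (fun s => e s ω) > V1 β σ f w T + u} ≤
      Real.exp (-u ^ 2 /
        (2 * ε ^ 2 * (β ^ 2 * T / (((w : ℝ) + 1) * σ ^ 2)) * fNormSq σ f w)) := by
  have := he.indep.isProbabilityMeasure
  have hsubset : {ω | g1 β w T f yhat (fun s => e s ω) > V1 β σ f w T + u} ⊆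
      {ω | T * Real.sqrt (fNormSq σ f w) + ((w : ℝ) + 1) * u / β ≤
        sumAbsError f w T fun s => e s ω} := fun ω hω => by
    have hlt := (Set.mem_ofPred_eq ▸ hω : V1 β σ f w T + u < _).trans_le (g1_le hβ.le w T f yhat _)
    have hV1 : V1 β σ f w T + u = 3 * β ^ 2 * T / ((w : ℝ) + 1) + β / ((w : ℝ) + 1) *
        (T * Real.sqrt (fNormSq σ f w) + ((w : ℝ) + 1) * u / β) := by
      rw [V1]
      field_simp
      ring
    rw [hV1, add_lt_add_iff_left] at hlt
    exact (lt_of_mul_lt_mul_left hlt (by positivity)).le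
  refine (measureReal_mono hsubset).trans
    ((he.measureReal_sumAbsError_ge_le hε f w (by positivity)).trans_eq (congrArg Real.exp ?_))
  rw [fNormSq_eq_sq_mul σ]
  field_simp

theorem IsNoise.measureReal_g2_gt_le (he : IsNoise μ T σ ε e) (hT : 1 ≤ T) (hσ : σ ≠ 0)
    (hf : f 0 ≠ 0) (w : ℕ) (yhat : ℤ → ℝ) (hu : 0 < u) :
    μ.real {ω | g2 w T f yhat (fun s => e s ω) > V2 σ f w T + u} ≤
      Real.exp (-u ^ 2 / (8 * ε ^ 2 * topEigenvalue w T f *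
        (T / ((w : ℝ) + 1) * bigF σ f w + u))) := by
  have := he.indep.isProbabilityMeasure
  have : (0 : ℝ) < T := by exact_mod_cast hT
  have hF := bigF_pos hσ hf w
  have hV2 : 0 < V2 σ f w T := by
    rw [V2]
    positivity
  have hmean := he.integral_g2_le w f yhat
  simp only [g2_eq] at hmean ⊢
  have htail := measureReal_half_sum_sq_mulVec_ge_le_exp he.indep
    (fun i => he.aemeasurable i i.2) (fun i => he.mean i i.2) (he.bound_pos hT hσ)
    (fun i => he.bound i i.2) (topEigenvalue_pos w hT hf)
    (sum_transpose_mulVec_sq_le (stackedMatrix w T f)) hmean hV2 hu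
  refine (measureReal_mono (Set.ofPred_subset_ofPred.2 fun _ hω => le_of_lt hω)).trans
    (htail.trans_eq ?_)
  rw [V2]
  congr 4
  field_simp

theorem IsNoise.measureReal_competitiveDifference_gt_le (he : IsNoise μ T σ ε e) (hT : 1 ≤ T)
    (hβ : 0 < β) (hσ : σ ≠ 0) (hf : f 0 ≠ 0) (w : ℕ) (yhat : ℤ → ℝ) (hu : 0 < u) :
    μ.real {ω | competitiveDifference β w T f yhat (fun s => e s ω) >
        V1 β σ f w T + V2 σ f w T + u} ≤
      Real.exp (-u ^ 2 /
          (8 * ε ^ 2 * (β ^ 2 * T / (((w : ℝ) + 1) * σ ^ 2)) * fNormSq σ f w)) +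
        Real.exp (-u ^ 2 / (16 * ε ^ 2 * topEigenvalue w T f *
          (2 * T / ((w : ℝ) + 1) * bigF σ f w + u))) := by
  have := he.indep.isProbabilityMeasure
  have hsubset : {ω | competitiveDifference β w T f yhat (fun s => e s ω) >
        V1 β σ f w T + V2 σ f w T + u} ⊆
      {ω | g1 β w T f yhat (fun s => e s ω) > V1 β σ f w T + u / 2} ∪
        {ω | g2 w T f yhat (fun s => e s ω) > V2 σ f w T + u / 2} := fun ω hω => by
    by_contra! hsmall
    simp only [Set.mem_union, Set.mem_ofPred_eq, not_or, not_lt] at hω hsmall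
    linarith [competitiveDifference_le hβ.le w T f yhat fun s => e s ω]
  refine (measureReal_mono hsubset).trans ((measureReal_union_le _ _).trans (add_le_add
    ((he.measureReal_g1_gt_le hβ hσ (he.bound_pos hT hσ).le w f yhat (by positivity)).trans_eq ?_)
    ((he.measureReal_g2_gt_le hT hσ hf w yhat (by positivity)).trans_eq ?_)))
  · congr 1
    field_simp
    norm_num
  · congr 1
    field_simp
    ring

theorem exp_neg_sq_div_le {c d : ℝ} (hc : 0 < c) (hcd : c ≤ d) (u : ℝ) :
    Real.exp (-u ^ 2 / c) ≤ Real.exp (-u ^ 2 / d) := by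
  simp only [neg_div]
  gcongr

theorem exp_add_exp_le_two_mul_exp {F N l : ℝ} (hT : 1 ≤ T) (hβ : 0 < β) (hσ : σ ≠ 0)
    (hε : 0 < ε) (w : ℕ) (hN : 0 < N) (hF : 0 < F) (hl : 0 < l) (hu : 0 < u) :
    Real.exp (-u ^ 2 / (8 * ε ^ 2 * (β ^ 2 * T / (((w : ℝ) + 1) * σ ^ 2)) * N)) +
        Real.exp (-u ^ 2 / (16 * ε ^ 2 * l * (2 * T / ((w : ℝ) + 1) * F + u))) ≤
      2 * Real.exp (-u ^ 2 / (8 * ε ^ 2 * T / ((w : ℝ) + 1) *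
        max (β ^ 2 * N / σ ^ 2) (4 * l * F) + 16 * ε ^ 2 * l * u)) := by
  have : (0 : ℝ) < T := by exact_mod_cast hT
  rw [two_mul (Real.exp _)]
  refine add_le_add (exp_neg_sq_div_le ?_ ?_ u) (exp_neg_sq_div_le ?_ ?_ u)
  · positivity
  · calc 8 * ε ^ 2 * (β ^ 2 * T / (((w : ℝ) + 1) * σ ^ 2)) * N
        = 8 * ε ^ 2 * T / ((w : ℝ) + 1) * (β ^ 2 * N / σ ^ 2) := by field_simp
      _ ≤ 8 * ε ^ 2 * T / ((w : ℝ) + 1) * max (β ^ 2 * N / σ ^ 2) (4 * l * F) := by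
        gcongr
        exact le_max_left _ _
      _ ≤ _ := le_add_of_nonneg_right (by positivity)
  · positivity
  · calc 16 * ε ^ 2 * l * (2 * T / ((w : ℝ) + 1) * F + u)
        = 8 * ε ^ 2 * T / ((w : ℝ) + 1) * (4 * l * F) + 16 * ε ^ 2 * l * u := by
          field_simp
          ring
      _ ≤ _ := by
        gcongr
        exact le_max_right _ _

end Tails

end OnlineLasso

open OnlineLasso in
theorem mainTheorem5_general {Ω : Type*} [MeasurableSpace Ω] {μ : Measure Ω} {T : ℕ} (w : ℕ)
    (hT : 1 ≤ T) {β σ ε : ℝ} (hβ : 0 < β) (hσ : σ ≠ 0) {f : ℤ → ℝ} (hf : f 0 ≠ 0) (yhat : ℤ → ℝ)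
    {e : ℤ → Ω → ℝ} (he : IsNoise μ T σ ε e) :
    let D : Ω → ℝ := fun ω => competitiveDifference β w T f yhat (fun s => e s ω)
    let G1 : Ω → ℝ := fun ω => g1 β w T f yhat (fun s => e s ω)
    let G2 : Ω → ℝ := fun ω => g2 w T f yhat (fun s => e s ω)
    let A := stackedMatrix w T f
    let lam : ℝ := topEigenvalue w T f
    let fw2 : ℝ := fNormSq σ f w
    let F : ℝ := bigF σ f w
    let V1 : ℝ := V1 β σ f w T
    let V2 : ℝ := V2 σ f w T
    let a : ℝ := 8 * ε ^ 2 * T / ((w : ℝ) + 1) * max (β ^ 2 * fw2 / σ ^ 2) (4 * lam * F)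
    let b : ℝ := 16 * ε ^ 2 * lam
    (∀ ω, D ω ≤ G1 ω + G2 ω) ∧
    (∀ ω, G2 ω = (1 / 2) * ∑ i, (A.mulVec (fun s => e s ω)) i ^ 2) ∧
    lam ≤ F / σ ^ 2 ∧
    (Integrable G1 μ ∧ ∫ ω, G1 ω ∂μ ≤ V1) ∧
    (Integrable G2 μ ∧ ∫ ω, G2 ω ∂μ ≤ V2) ∧
    (Integrable D μ ∧ ∫ ω, D ω ∂μ ≤ V1 + V2) ∧
    (∀ u : ℝ, 0 < u →
      μ.real {ω | G1 ω > V1 + u} ≤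
        Real.exp (-u ^ 2 / (2 * ε ^ 2 * (β ^ 2 * T / (((w : ℝ) + 1) * σ ^ 2)) * fw2)) ∧
      μ.real {ω | G2 ω > V2 + u} ≤
        Real.exp (-u ^ 2 / (8 * ε ^ 2 * lam * (T / ((w : ℝ) + 1) * F + u))) ∧
      μ.real {ω | D ω > V1 + V2 + u} ≤
        Real.exp (-u ^ 2 / (8 * ε ^ 2 * (β ^ 2 * T / (((w : ℝ) + 1) * σ ^ 2)) * fw2)) +
          Real.exp (-u ^ 2 / (16 * ε ^ 2 * lam * (2 * T / ((w : ℝ) + 1) * F + u))) ∧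
      Real.exp (-u ^ 2 / (8 * ε ^ 2 * (β ^ 2 * T / (((w : ℝ) + 1) * σ ^ 2)) * fw2)) +
          Real.exp (-u ^ 2 / (16 * ε ^ 2 * lam * (2 * T / ((w : ℝ) + 1) * F + u))) ≤
        2 * Real.exp (-u ^ 2 / (a + b * u))) := by
  have hε := he.bound_pos hT hσ
  refine ⟨fun ω => competitiveDifference_le hβ.le w T f yhat _, fun ω => g2_eq w T f yhat _,
    topEigenvalue_le_bigF_div hσ w T f, ⟨he.integrable_g1 hβ.le w f yhat,
      he.integral_g1_le hβ.le w f yhat⟩, ⟨he.integrable_g2 w f yhat, he.integral_g2_le w f yhat⟩,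
    ⟨he.integrable_competitiveDifference hβ.le w f yhat,
      he.integral_competitiveDifference_le hβ.le w f yhat⟩,
    fun u hu => ⟨he.measureReal_g1_gt_le hβ hσ hε.le w f yhat hu.le,
      he.measureReal_g2_gt_le hT hσ hf w yhat hu,
      he.measureReal_competitiveDifference_gt_le hT hβ hσ hf w yhat hu, ?_⟩⟩
  exact exp_add_exp_le_two_mul_exp hT hβ hσ hε w (fNormSq_pos hσ hf w) (bigF_pos hσ hf w)
    (topEigenvalue_pos w hT hf) hu

theorem mainTheorem5 {Ω : Type*} [MeasurableSpace Ω] (μ : Measure Ω) [IsProbabilityMeasure μ]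
    (T w : ℕ) (hT : 1 ≤ T) (β σ ε : ℝ) (hβ : 0 < β) (hσ : 0 < σ)
    (f : ℤ → ℝ) (hf0 : f 0 = 1) (hfneg : ∀ t < 0, f t = 0)
    (yhat : ℤ → ℝ)
    (e : ℤ → Ω → ℝ)
    (hindep : iIndepFun (fun s : OnlineLasso.Slot T => e s) μ)
    (hident : ∀ s ∈ Finset.Icc (1 : ℤ) T, IdentDistrib (e s) (e 1) μ μ)
    (hmean : ∀ s ∈ Finset.Icc (1 : ℤ) T, ∫ ω, e s ω ∂μ = 0)
    (hvar : ∀ s ∈ Finset.Icc (1 : ℤ) T, ∫ ω, e s ω ^ 2 ∂μ = σ ^ 2)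
    (hbdd : ∀ s ∈ Finset.Icc (1 : ℤ) T, ∀ᵐ ω ∂μ, |e s ω| ≤ ε) :
    let D : Ω → ℝ := fun ω => OnlineLasso.competitiveDifference β w T f yhat (fun s => e s ω)
    let G1 : Ω → ℝ := fun ω => OnlineLasso.g1 β w T f yhat (fun s => e s ω)
    let G2 : Ω → ℝ := fun ω => OnlineLasso.g2 w T f yhat (fun s => e s ω)
    let A := OnlineLasso.stackedMatrix w T f
    let lam : ℝ := OnlineLasso.topEigenvalue w T f
    let fw2 : ℝ := OnlineLasso.fNormSq σ f w
    let F : ℝ := OnlineLasso.bigF σ f w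
    let V1 : ℝ := OnlineLasso.V1 β σ f w T
    let V2 : ℝ := OnlineLasso.V2 σ f w T
    let a : ℝ := 8 * ε ^ 2 * T / ((w : ℝ) + 1) * max (β ^ 2 * fw2 / σ ^ 2) (4 * lam * F)
    let b : ℝ := 16 * ε ^ 2 * lam
    -- the two penalty terms and the quadratic form of the second one
    (∀ ω, D ω ≤ G1 ω + G2 ω) ∧
    (∀ ω, G2 ω = (1 / 2) * ∑ i, (A.mulVec (fun s => e s ω)) i ^ 2) ∧
    lam ≤ F / σ ^ 2 ∧
    -- `V1`, `V2`, `V1 + V2` bound the means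
    (Integrable G1 μ ∧ ∫ ω, G1 ω ∂μ ≤ V1) ∧
    (Integrable G2 μ ∧ ∫ ω, G2 ω ∂μ ≤ V2) ∧
    (Integrable D μ ∧ ∫ ω, D ω ∂μ ≤ V1 + V2) ∧
    -- tail bounds
    (∀ u : ℝ, 0 < u →
      μ.real {ω | G1 ω > V1 + u} ≤
        Real.exp (-u ^ 2 / (2 * ε ^ 2 * (β ^ 2 * T / (((w : ℝ) + 1) * σ ^ 2)) * fw2)) ∧
      μ.real {ω | G2 ω > V2 + u} ≤
        Real.exp (-u ^ 2 / (8 * ε ^ 2 * lam * (T / ((w : ℝ) + 1) * F + u))) ∧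
      μ.real {ω | D ω > V1 + V2 + u} ≤
        Real.exp (-u ^ 2 / (8 * ε ^ 2 * (β ^ 2 * T / (((w : ℝ) + 1) * σ ^ 2)) * fw2)) +
          Real.exp (-u ^ 2 / (16 * ε ^ 2 * lam * (2 * T / ((w : ℝ) + 1) * F + u))) ∧
      Real.exp (-u ^ 2 / (8 * ε ^ 2 * (β ^ 2 * T / (((w : ℝ) + 1) * σ ^ 2)) * fw2)) +
          Real.exp (-u ^ 2 / (16 * ε ^ 2 * lam * (2 * T / ((w : ℝ) + 1) * F + u))) ≤
        2 * Real.exp (-u ^ 2 / (a + b * u))) :=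
  mainTheorem5_general w hT hβ hσ.ne' (hf0 ▸ one_ne_zero) yhat
    ⟨hindep, fun s hs => (hident s hs).aemeasurable_fst, hmean, hvar, hbdd⟩
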